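/- Let $\mathcal H$ be a complex Hilbert space and consider for $t\ge 0$ the random Schrödinger equation $$ i\,\partial_t\phi(t)=H_0\phi(t)+\varepsilon\,g(t)\,\beta\,\phi(t),\qquad \phi(0)=\phi_0,\qquad \varepsilon\in\mathbb R,\ |\varepsilon|\le 1 ,$$ under the following assumptions. (H1) $H_0$ is a self-adjoint operator on $\mathcal H$ with a complete orthonormal set of eigenvectors $\{\psi_j\}$, finite or countably infinite: $H_0\psi_j=\lambda_j\psi_j$. (H2) $\beta$ is a bounded self-adjoint operator on $\mathcal H$ with $\|\beta\|=1$. (H3) $g_0\in L^2(\mathbb R)$ is real valued, vanishes outside $[0,T]$, and $\|g_0\|_{L^1}=1$. (H4) $d_0,d_1,\dots$ are independent identically distributed nonnegative random variables with $\mathbb E\big(e^{i(\lambda_j-\lambda_k)d_l}\big)=0$ for all $l\ge 0$ and all $j\ne k$. Here $g(t)=\sum_{n\ge 0}g_0(t-t_n)$ is a train of defects with onset times $t_0=d_0$, $t_n=(d_0+T)+\dots+(d_{n-1}+T)+d_n$ for $n\ge1$. Assume moreover that the $d_j$ have finite mean $M$, finite variance and finite third moment. The initial state $\phi_0$ is deterministic,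 or more generally random with $\mathbb E\|\phi_0\|^2<\infty$ and independent of $(d_j)_{j\ge 0}$. The solution $\phi$ is continuous in time with values in $\mathcal H$ and satisfies the equation in the weak sense (tested against vectors of the domain of $H_0$ and integrated in time). Let $P(t)=(P_k(t))_k$, $P_k(t)=\mathbb E\,|\langle\psi_k,\phi(t)\rangle|^2$, be the expected power vector. Put $\alpha_{kj}=\langle\psi_k,\beta\psi_j\rangle$, $\Delta_{kj}=\lambda_k-\lambda_j$, $\hat g_0(\xi)=\int e^{-i\xi t}g_0(t)\,dt$, and let $T_\varepsilon=\mathbb I-\varepsilon^2B$, where $$ b_{kj}=-|\alpha_{kj}|^2|\hat g_0(-\Delta_{kj})|^2\quad (j\neq k),\qquad b_{kk}=\sum_{l\ne k}|\alpha_{kl}|^2|\hat g_0(-\Delta_{kl})|^2 . $$ Then there is a constant $C\ge 0$, independent of $\varepsilon$, of $t$ and of the initial state, such that for all $\varepsilon$ with $|\varepsilon|\le 1$ and all times $t$ with $0\le t\le|\varepsilon|^{-3}$ (any $t\geq 0$ if $\varepsilon=0$), with $n=\lfloor t/(T+M)\rfloor$, $$ \big\|P(t)-T_\varepsilon^{\,n}P(0)\big\|_{\ell^1}\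 \le\ C\;\mathbb E\|\phi_0\|^2\;\max\{t|\varepsilon|^3,\ |\varepsilon|^{4/5}\} .$$ In particular, for $0\le t\ll|\varepsilon|^{-3}$, $P(t)=T_\varepsilon^nP(0)+\mathcal O(\max\{t|\varepsilon|^3,|\varepsilon|^{4/5}\})$ in $\ell^1$. -/

import Mathlib

open MeasureTheory ProbabilityTheory

noncomputable section

namespace RandomDefects

/-- Fourier transform `ĝ(ξ) = ∫ e^{-iξt} g(t) dt` of a real function. -/
def fourierHat (g : ℝ → ℝ) (ξ : ℝ) : ℂ :=
  ∫ t : ℝ, Complex.exp (-(Complex.I * ξ * t)) * (g t : ℂ)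

/-- Onset time of the `n`-th defect for the waiting times `d`:
`t_n = (d_0 + T) + ⋯ + (d_{n-1} + T) + d_n`. -/
def onset (T : ℝ) (d : ℕ → ℝ) (n : ℕ) : ℝ :=
  (∑ i ∈ Finset.range n, (d i + T)) + d n

/-- The train of defects `g(t) = ∑_{n ≥ 0} g₀(t - t_n)`. -/
def train (T : ℝ) (g₀ : ℝ → ℝ) (d : ℕ → ℝ) (t : ℝ) : ℝ :=
  ∑' n : ℕ, g₀ (t - onset T d n)

section System

variable {H : Type*} [NormedAddCommGroup H] [InnerProductSpace ℂ H]

/-- `φ` is a (weak) solution on `[0, ∞)` of `i ∂ₜ φ = H₀ φ + ε g(t) β φ`, `φ(0) = φ₀`: it is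
continuous into `H`, and tested against any vector `v` of the domain of the self-adjoint operator
`H₀` it satisfies the time-integrated equation. -/
def IsSolution (H₀ : H →ₗ.[ℂ] H) (β : H →L[ℂ] H) (ε : ℝ) (g : ℝ → ℝ) (φ₀ : H)
    (φ : ℝ → H) : Prop :=
  ContinuousOn φ (Set.Ici 0) ∧
  ∀ t : ℝ, 0 ≤ t → ∀ v : H₀.domain,
    inner ℂ (v : H) (φ t) = inner ℂ (v : H) φ₀ +
      ∫ s in (0 : ℝ)..t, -Complex.I *
        (inner ℂ (H₀ v) (φ s) + (ε : ℂ) * (g s : ℂ) * inner ℂ (v : H) (β (φ s)))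

variable {ι : Type*}

/-- The rates `|α_{kj}|² |ĝ₀(-Δ_{kj})|²`, with `α_{kj} = ⟨ψ_k, β ψ_j⟩` and
`Δ_{kj} = λ_k - λ_j`. -/
def rate (ψ : HilbertBasis ι ℂ H) (ev : ι → ℝ) (β : H →L[ℂ] H) (g₀ : ℝ → ℝ) (k j : ι) : ℝ :=
  ‖inner ℂ (ψ k) (β (ψ j))‖ ^ 2 * ‖fourierHat g₀ (-(ev k - ev j))‖ ^ 2

open Classical in
/-- The (possibly infinite) matrix `B`: off the diagonal it is minus the rate, and on the diagonal
the sum of the off-diagonal rates of the row. -/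
def matB (ψ : HilbertBasis ι ℂ H) (ev : ι → ℝ) (β : H →L[ℂ] H) (g₀ : ℝ → ℝ) : Matrix ι ι ℝ :=
  fun k j =>
    if j = k then ∑' l : ι, (if l = k then 0 else rate ψ ev β g₀ k l)
    else -rate ψ ev β g₀ k j

/-- The operator `T_ε = I - ε² B` acting on power vectors. -/
def transfer (ψ : HilbertBasis ι ℂ H) (ev : ι → ℝ) (β : H →L[ℂ] H) (g₀ : ℝ → ℝ) (ε : ℝ)
    (p : ι → ℝ) : ι → ℝ :=
  fun k => p k - ε ^ 2 * ∑' j : ι, matB ψ ev β g₀ k j * p j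

/-- Expected power vector `P_k = 𝔼 |⟨ψ_k, Φ⟩|²` of a random state `Φ`. -/
def power {Ω : Type*} [MeasurableSpace Ω] (μ : Measure Ω) (ψ : HilbertBasis ι ℂ H)
    (Φ : Ω → H) : ι → ℝ :=
  fun k => ∫ ω, ‖inner ℂ (ψ k) (Φ ω)‖ ^ 2 ∂μ

end System

end RandomDefects

end

/-! Between defects the free evolution only multiplies coordinates by phases, and each defect acts,
up to such phases, by one fixed unitary `S T`, where `S` is the propagator of a single defect in the
interaction picture (`IsSolution.eq_propagator`, `IsSolution.eq_stateAt`). Every waiting time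
randomises the phases independently of the past, so (H4) kills all cross terms, and the expected
powers after n defects are Q^n P(0) with the column-stochastic matrix Q_kj = |⟨ψ_k, S T ψ_j⟩|²
(`integral_stateAt_eq_iterate`).

The first Dyson term identifies the off-diagonal part of Q with that of T_ε up to O(|ε|³) in ℓ¹ of
each column. The diagonal follows because the columns of both matrices sum to one
(`l1Le_trans_sub_transferMat`). Both matrices contract ℓ¹, so n ≤ t/(T+M) iterations cost O(t|ε|³)
(`l1Le_iterate_sub`).

It remains to replace the random number of defects met before t by n. At cost O(|ε|) the state at t
becomes the state after the next defect (`IsSolution.l1Le_power_sub`). The difference to the state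
after n defects telescopes into single steps l → l+1 weighted by `miscount`, which depends only on
d_0, ..., d_{l-1}. The average over d_l therefore still applies, and the step contributes O(ε²
𝔼|miscount|) (`l1Le_integral_miscount`). Chebyshev's inequality bounds the sum of these expectations
by O(√t + 1) (`integral_abs_miscount_le`, `sum_chebWeight_dist_le`). Finally ε²√t is the geometric
mean of |ε| and t|ε|³, and |ε| ≤ |ε|^(4/5) (`error_le`). -/

noncomputable section

namespace RandomDefects

/-! ### Calculus of absolutely continuous vector-valued functions. -/

section AbsolutelyContinuous

variable {F : Type*} [NormedAddCommGroup F]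

theorem absolutelyContinuous_const_add {f : ℝ → F} {a b : ℝ}
    (hf : AbsolutelyContinuousOnInterval f a b) (c : F) :
    AbsolutelyContinuousOnInterval (fun x => c + f x) a b := by
  simpa [AbsolutelyContinuousOnInterval] using hf

variable [NormedSpace ℝ F]

theorem absolutelyContinuous_of_dist_le {X : Type*} [PseudoMetricSpace X] {f : ℝ → X} {g : ℝ → ℝ}
    {a b : ℝ} (hg : AbsolutelyContinuousOnInterval g a b)
    (h : ∀ x ∈ Set.uIcc a b, ∀ y ∈ Set.uIcc a b, dist (f x) (f y) ≤ dist (g x) (g y)) :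
    AbsolutelyContinuousOnInterval f a b := by
  rw [absolutelyContinuousOnInterval_iff] at hg ⊢
  intro ε hε
  obtain ⟨δ, hδ, H⟩ := hg ε hε
  refine ⟨δ, hδ, fun E hE hlt => lt_of_le_of_lt (Finset.sum_le_sum fun i hi => ?_) (H E hE hlt)⟩
  exact h _ (hE.1 i hi).1 _ (hE.1 i hi).2

/-- Increments of the primitive of `f` are dominated by those of the scalar primitive of `‖f‖`. -/
theorem absolutelyContinuous_integral {f : ℝ → F} {a b : ℝ}
    (hf : IntervalIntegrable f volume a b) :
    AbsolutelyContinuousOnInterval (fun x => ∫ v in a..x, f v) a b := by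
  refine absolutelyContinuous_of_dist_le
    (hf.norm.absolutelyContinuousOnInterval_intervalIntegral Set.left_mem_uIcc) ?_
  intro x hx y hy
  have h1 : ∀ z ∈ Set.uIcc a b, IntervalIntegrable f volume a z := fun z hz =>
    hf.mono_set (Set.uIcc_subset_uIcc_left hz)
  rw [dist_eq_norm, dist_eq_norm,
    intervalIntegral.integral_interval_sub_left (h1 x hx) (h1 y hy),
    intervalIntegral.integral_interval_sub_left (h1 x hx).norm (h1 y hy).norm, Real.norm_eq_abs]
  exact intervalIntegral.norm_integral_le_abs_integral_norm

/-- The fundamental theorem of calculus for absolutely continuous vector-valued functions. -/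
theorem eq_add_integral_of_ae_hasDerivAt [CompleteSpace F] {f f' : ℝ → F} {a b : ℝ}
    (hf : AbsolutelyContinuousOnInterval f a b) (hf' : IntervalIntegrable f' volume a b)
    (h : ∀ᵐ x, x ∈ Set.uIcc a b → HasDerivAt f (f' x) x) :
    f b = f a + ∫ x in a..b, f' x := by
  obtain ⟨C, hC⟩ := (hf.fun_sub (absolutelyContinuous_integral hf')).const_of_ae_hasDerivAt_zero (by
    filter_upwards [h, hf'.ae_hasDerivAt_integral] with x h1 h2 hx
    have := (h1 hx).sub (h2 hx a Set.left_mem_uIcc)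
    rwa [sub_self] at this)
  have ha := hC a Set.left_mem_uIcc
  have hb := hC b Set.right_mem_uIcc
  simp only [intervalIntegral.integral_same, sub_zero] at ha
  rw [← ha] at hb
  rw [← hb]; abel

theorem ae_hasDerivAt_const_add_integral [CompleteSpace F] {f : ℝ → F} {a b : ℝ}
    (hf : IntervalIntegrable f volume a b) (c : F) :
    ∀ᵐ x, x ∈ Set.uIcc a b → HasDerivAt (fun r => c + ∫ s in a..r, f s) (f x) x := by
  filter_upwards [hf.ae_hasDerivAt_integral] with x h hx
  exact (h hx a Set.left_mem_uIcc).const_add c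

end AbsolutelyContinuous

/-- The norm is conserved along a solution of `v' = f` when `f` is orthogonal to `v` for the
real inner product. -/
theorem norm_eq_of_re_inner_eq_zero {H : Type*} [NormedAddCommGroup H] [InnerProductSpace ℂ H]
    [CompleteSpace H] {v f : ℝ → H} {a b : ℝ} (hf : IntervalIntegrable f volume a b)
    (hv : ∀ r ∈ Set.uIcc a b, v r = v a + ∫ s in a..r, f s)
    (h : ∀ s ∈ Set.uIcc a b, (inner ℂ (v s) (f s)).re = 0) : ‖v b‖ = ‖v a‖ := by
  set V : ℝ → H := fun r => v a + ∫ s in a..r, f s with hV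
  have hac : AbsolutelyContinuousOnInterval V a b :=
    absolutelyContinuous_const_add (absolutelyContinuous_integral hf) _
  have hn : AbsolutelyContinuousOnInterval (fun r => ‖V r‖) a b := by
    unfold AbsolutelyContinuousOnInterval at hac ⊢
    exact squeeze_zero (fun _ => Finset.sum_nonneg fun _ _ => dist_nonneg)
      (fun _ => Finset.sum_le_sum fun _ _ => (dist_norm_norm_le _ _).trans_eq
        (dist_eq_norm _ _).symm) hac
  -- The inner square has the same increments, in modulus, as the product of the absolutely
  -- continuous function `‖V‖` with itself.
  have hi : AbsolutelyContinuousOnInterval (fun r => (inner ℂ (V r) (V r) : ℂ)) a b := by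
    refine absolutelyContinuous_of_dist_le (hn.fun_mul hn) fun x _ y _ => ?_
    simp only [inner_self_eq_norm_sq_to_K, dist_eq_norm, ← sq]
    rw [← Complex.norm_real]
    simp
  have hd : ∀ᵐ x, x ∈ Set.uIcc a b →
      HasDerivAt (fun r => (inner ℂ (V r) (V r) : ℂ)) 0 x := by
    filter_upwards [ae_hasDerivAt_const_add_integral hf (v a)] with x hx hxm
    refine ((hx hxm).inner ℂ (hx hxm)).congr_deriv ?_
    have e := h x hxm
    rw [hv x hxm] at e
    rw [← inner_conj_symm (f x), Complex.add_conj, e]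
    simp
  obtain ⟨C, hC⟩ := hi.const_of_ae_hasDerivAt_zero hd
  have e := (hC a Set.left_mem_uIcc).trans (hC b Set.right_mem_uIcc).symm
  have ea : V a = v a := (hv a Set.left_mem_uIcc).symm
  have eb : V b = v b := (hv b Set.right_mem_uIcc).symm
  simp only [ea, eb, inner_self_eq_norm_sq_to_K] at e
  have e' : ‖v a‖ ^ 2 = ‖v b‖ ^ 2 := by exact_mod_cast e
  exact ((pow_left_inj₀ (norm_nonneg _) (norm_nonneg _) two_ne_zero).1 e').symm

/-- Variation of constants for a scalar linear equation with an integrable source. -/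
theorem exp_mul_eq_of_integral_eq {y f : ℝ → ℂ} {l t : ℝ} (hyc : ContinuousOn y (Set.uIcc 0 t))
    (hf : IntervalIntegrable f volume 0 t)
    (hy : ∀ r ∈ Set.uIcc 0 t, y r = y 0 + ∫ s in (0 : ℝ)..r, -Complex.I * (l * y s + f s)) :
    Complex.exp (Complex.I * (l * t : ℝ)) * y t =
      y 0 + ∫ s in (0 : ℝ)..t, Complex.exp (Complex.I * (l * s : ℝ)) * (-Complex.I * f s) := by
  have hint : IntervalIntegrable (fun s => -Complex.I * (l * y s + f s)) volume 0 t :=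
    (((hyc.intervalIntegrable).const_mul _).add hf).const_mul _
  set Y : ℝ → ℂ := fun r => y 0 + ∫ s in (0 : ℝ)..r, -Complex.I * (l * y s + f s) with hY
  have hexp : ∀ x : ℝ, HasDerivAt (fun r : ℝ => Complex.exp (Complex.I * (l * r : ℝ)))
      (Complex.exp (Complex.I * (l * x : ℝ)) * (Complex.I * l)) x := by
    intro x
    refine HasDerivAt.cexp ?_
    have := ((hasDerivAt_id x).const_mul l).ofReal_comp.const_mul Complex.I
    simpa using this
  have hcd : ContDiff ℝ 1 (fun r : ℝ => Complex.exp (Complex.I * (l * r : ℝ))) := by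
    have : ContDiff ℝ 1 (fun r : ℝ => ((l * r : ℝ) : ℂ)) :=
      Complex.ofRealCLM.contDiff.comp (contDiff_const.mul contDiff_id)
    exact (contDiff_const.mul this).cexp
  have hexpc : Continuous (fun r : ℝ => Complex.exp (Complex.I * (l * r : ℝ))) := by fun_prop
  have key := eq_add_integral_of_ae_hasDerivAt (a := 0) (b := t)
    (f := fun r => Complex.exp (Complex.I * (l * r : ℝ)) • Y r)
    (f' := fun s => Complex.exp (Complex.I * (l * s : ℝ)) * (-Complex.I * f s))
    (hcd.contDiffOn.absolutelyContinuousOnInterval.fun_smul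
      (absolutelyContinuous_const_add (absolutelyContinuous_integral hint) _))
    ((hf.const_mul _).continuousOn_mul hexpc.continuousOn)
    (by
      filter_upwards [ae_hasDerivAt_const_add_integral hint (y 0)] with x hx hxm
      refine ((hexp x).smul (hx hxm)).congr_deriv ?_
      rw [← hy x hxm]
      simp only [smul_eq_mul]
      ring)
  have e0 : Y 0 = y 0 := by simp [hY]
  have et : Y t = y t := (hy t Set.right_mem_uIcc).symm
  simpa [e0, et] using key

/-! ### Families with bounded `ℓ¹` norm -/

section L1

variable {ι : Type*}

/-- The family `p` has `ℓ¹` norm at most `c`. -/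
def L1Le (p : ι → ℝ) (c : ℝ) : Prop := ∀ s : Finset ι, ∑ k ∈ s, |p k| ≤ c

theorem L1Le.abs_le {p : ι → ℝ} {c : ℝ} (h : L1Le p c) (k : ι) : |p k| ≤ c := by
  simpa using h {k}

theorem L1Le.summable {p : ι → ℝ} {c : ℝ} (h : L1Le p c) : Summable fun k => |p k| :=
  summable_of_sum_le (fun _ => abs_nonneg _) h

theorem L1Le.tsum_le {p : ι → ℝ} {c : ℝ} (h : L1Le p c) : ∑' k, |p k| ≤ c :=
  Real.tsum_le_of_sum_le (fun _ => abs_nonneg _) h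

theorem L1Le.mono {p : ι → ℝ} {c c' : ℝ} (h : L1Le p c) (hc : c ≤ c') : L1Le p c' :=
  fun s => (h s).trans hc

theorem L1Le.add {p q : ι → ℝ} {a b : ℝ} (hp : L1Le p a) (hq : L1Le q b) :
    L1Le (fun k => p k + q k) (a + b) := fun s =>
  (Finset.sum_le_sum fun _ _ => abs_add_le _ _).trans
    (by rw [Finset.sum_add_distrib]; exact add_le_add (hp s) (hq s))

theorem L1Le.neg {p : ι → ℝ} {a : ℝ} (hp : L1Le p a) : L1Le (fun k => -p k) a := fun s => by
  simpa using hp s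

theorem L1Le.sub {p q : ι → ℝ} {a b : ℝ} (hp : L1Le p a) (hq : L1Le q b) :
    L1Le (fun k => p k - q k) (a + b) := by
  simpa [sub_eq_add_neg] using hp.add hq.neg

theorem L1Le.const_mul {p : ι → ℝ} {a : ℝ} (hp : L1Le p a) (r : ℝ) :
    L1Le (fun k => r * p k) (|r| * a) := fun s => by
  simp only [abs_mul, ← Finset.mul_sum]
  exact mul_le_mul_of_nonneg_left (hp s) (abs_nonneg _)

theorem L1Le.sum {α : Type*} (t : Finset α) {p : α → ι → ℝ} {a : α → ℝ}
    (hp : ∀ i ∈ t, L1Le (p i) (a i)) : L1Le (fun k => ∑ i ∈ t, p i k) (∑ i ∈ t, a i) := fun s => by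
  calc ∑ k ∈ s, |∑ i ∈ t, p i k| ≤ ∑ k ∈ s, ∑ i ∈ t, |p i k| :=
        Finset.sum_le_sum fun _ _ => Finset.abs_sum_le_sum_abs _ _
    _ = ∑ i ∈ t, ∑ k ∈ s, |p i k| := Finset.sum_comm
    _ ≤ ∑ i ∈ t, a i := Finset.sum_le_sum fun i hi => hp i hi s

/-- The action of an infinite matrix. -/
def act (K : ι → ι → ℝ) (p : ι → ℝ) : ι → ℝ := fun k => ∑' j, K k j * p j

/-- Column bounds make all entries at most `a` in modulus, which suffices along a row because `p` is
in ℓ¹. -/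
theorem summable_act {K : ι → ι → ℝ} {p : ι → ℝ} {a c : ℝ} (hK : ∀ j, L1Le (fun k => K k j) a)
    (hp : L1Le p c) (k : ι) : Summable fun j => |K k j * p j| := by
  refine Summable.of_nonneg_of_le (fun _ => abs_nonneg _) (fun j => ?_) (hp.summable.mul_left a)
  rw [abs_mul]
  exact mul_le_mul_of_nonneg_right ((hK j).abs_le k) (abs_nonneg _)

/-- A matrix whose columns have `ℓ¹` norm at most `a` acts on `ℓ¹` with norm at most `a`. -/
theorem L1Le.act {K : ι → ι → ℝ} {p : ι → ℝ} {a c : ℝ} (hK : ∀ j, L1Le (fun k => K k j) a)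
    (ha : 0 ≤ a) (hp : L1Le p c) : L1Le (act K p) (a * c) := fun s => by
  have hs := summable_act hK hp
  calc ∑ k ∈ s, |RandomDefects.act K p k| ≤ ∑ k ∈ s, ∑' j, |K k j * p j| :=
        Finset.sum_le_sum fun k _ => by
          have := norm_tsum_le_tsum_norm (f := fun j => K k j * p j) (by simpa using hs k)
          simpa [RandomDefects.act] using this
    _ = ∑' j, ∑ k ∈ s, |K k j * p j| := (Summable.tsum_finsetSum fun k _ => hs k).symm
    _ ≤ ∑' j, a * |p j| := by
        refine Summable.tsum_le_tsum (fun j => ?_) (summable_sum fun k _ => hs k)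
          (hp.summable.mul_left a)
        simp only [abs_mul, ← Finset.sum_mul]
        exact mul_le_mul_of_nonneg_right (hK j s) (abs_nonneg _)
    _ = a * ∑' j, |p j| := tsum_mul_left
    _ ≤ a * c := mul_le_mul_of_nonneg_left hp.tsum_le ha

theorem act_sub_left {K L : ι → ι → ℝ} {p : ι → ℝ} {a b c : ℝ}
    (hK : ∀ j, L1Le (fun k => K k j) a) (hL : ∀ j, L1Le (fun k => L k j) b) (hp : L1Le p c)
    (k : ι) : act (fun i j => K i j - L i j) p k = act K p k - act L p k := by
  simp only [act, sub_mul]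
  exact (summable_act hK hp k).of_abs.tsum_sub (summable_act hL hp k).of_abs

theorem act_sub_right {K : ι → ι → ℝ} {p q : ι → ℝ} {a b c : ℝ}
    (hK : ∀ j, L1Le (fun k => K k j) a) (hp : L1Le p b) (hq : L1Le q c)
    (k : ι) : act K (fun j => p j - q j) k = act K p k - act K q k := by
  simp only [act, mul_sub]
  exact (summable_act hK hp k).of_abs.tsum_sub (summable_act hK hq k).of_abs

theorem L1Le.integral {Ω : Type*} [MeasurableSpace Ω] {μ : Measure Ω} {p : Ω → ι → ℝ}
    {c : Ω → ℝ} (hp : ∀ k, Integrable (fun ω => p ω k) μ) (hc : Integrable c μ)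
    (h : ∀ᵐ ω ∂μ, L1Le (p ω) (c ω)) : L1Le (fun k => ∫ ω, p ω k ∂μ) (∫ ω, c ω ∂μ) := fun s => by
  calc ∑ k ∈ s, |∫ ω, p ω k ∂μ| ≤ ∑ k ∈ s, ∫ ω, |p ω k| ∂μ :=
        Finset.sum_le_sum fun k _ => abs_integral_le_integral_abs
    _ = ∫ ω, ∑ k ∈ s, |p ω k| ∂μ := (integral_finsetSum _ fun k _ => (hp k).abs).symm
    _ ≤ ∫ ω, c ω ∂μ := integral_mono_ae (integrable_finsetSum _ fun k _ => (hp k).abs) hc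
        (h.mono fun ω hω => hω s)

end L1

/-! ### Diagonal unitaries, the free flow and the coupling in the interaction picture. -/

section Phase

variable {H : Type*} [NormedAddCommGroup H] [InnerProductSpace ℂ H] {ι : Type*}
  (ψ : HilbertBasis ι ℂ H)

theorem ext_inner_basis {x y : H} (h : ∀ k, inner ℂ (ψ k) x = inner ℂ (ψ k) y) : x = y := by
  apply ψ.repr.injective
  ext k
  simpa [ψ.repr_apply_apply] using h k

theorem norm_exp_I_mul (a : ℝ) : ‖Complex.exp (Complex.I * a)‖ = 1 := by
  rw [mul_comm]; exact Complex.norm_exp_ofReal_mul_I a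

theorem conj_exp_I_mul (a : ℝ) :
    (starRingEnd ℂ) (Complex.exp (Complex.I * a)) = Complex.exp (Complex.I * (-a : ℝ)) := by
  rw [← Complex.exp_conj]; simp

theorem exp_I_mul_mul_exp (a b : ℝ) :
    Complex.exp (Complex.I * a) * Complex.exp (Complex.I * b) =
      Complex.exp (Complex.I * (a + b : ℝ)) := by
  rw [← Complex.exp_add]; push_cast; ring_nf

theorem orthonormal_phase (θ : ι → ℝ) :
    Orthonormal ℂ fun k => Complex.exp (Complex.I * θ k) • ψ k := by
  refine ⟨fun k => ?_, fun i j hij => ?_⟩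
  · rw [norm_smul, norm_exp_I_mul, one_mul]
    exact ψ.orthonormal.1 k
  · change inner ℂ (Complex.exp (Complex.I * θ i) • ψ i) (Complex.exp (Complex.I * θ j) • ψ j) = 0
    rw [inner_smul_left, inner_smul_right, ψ.orthonormal.2 hij, mul_zero, mul_zero]

theorem top_le_span_phase (θ : ι → ℝ) :
    ⊤ ≤ (Submodule.span ℂ
      (Set.range fun k => Complex.exp (Complex.I * θ k) • ψ k)).topologicalClosure := by
  rw [← ψ.dense_span]
  refine Submodule.topologicalClosure_mono (Submodule.span_le.2 ?_)
  rintro _ ⟨k, rfl⟩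
  have : ψ k = Complex.exp (Complex.I * (-θ k : ℝ)) • (Complex.exp (Complex.I * θ k) • ψ k) := by
    rw [smul_smul, exp_I_mul_mul_exp]; simp
  rw [this]
  exact Submodule.smul_mem _ _ (Submodule.subset_span ⟨k, rfl⟩)

/-- The coordinates of two vectors differ little in modulus squared. -/
theorem l1Le_norm_sq_sub (x y : H) :
    L1Le (fun k => ‖inner ℂ (ψ k) x‖ ^ 2 - ‖inner ℂ (ψ k) y‖ ^ 2)
      (‖x - y‖ * (‖x‖ + ‖y‖)) := by
  intro s
  have bes : ∀ z : H, √(∑ k ∈ s, ‖inner ℂ (ψ k) z‖ ^ 2) ≤ ‖z‖ := fun z =>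
    (Real.sqrt_le_sqrt (ψ.orthonormal.sum_inner_products_le z)).trans_eq
      (Real.sqrt_sq (norm_nonneg _))
  have cs : ∀ z : H, ∑ k ∈ s, ‖inner ℂ (ψ k) (x - y)‖ * ‖inner ℂ (ψ k) z‖ ≤ ‖x - y‖ * ‖z‖ :=
    fun z => (Real.sum_mul_le_sqrt_mul_sqrt s _ _).trans
      (mul_le_mul (bes _) (bes _) (Real.sqrt_nonneg _) (norm_nonneg _))
  calc ∑ k ∈ s, |‖inner ℂ (ψ k) x‖ ^ 2 - ‖inner ℂ (ψ k) y‖ ^ 2|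
      ≤ ∑ k ∈ s, (‖inner ℂ (ψ k) (x - y)‖ * ‖inner ℂ (ψ k) x‖ +
          ‖inner ℂ (ψ k) (x - y)‖ * ‖inner ℂ (ψ k) y‖) := by
        refine Finset.sum_le_sum fun k _ => ?_
        -- Factoring the difference of squares leaves two sums, each controlled by Cauchy–Schwarz
        -- and Bessel.
        rw [sq_sub_sq, abs_mul, ← mul_add, mul_comm, abs_of_nonneg (a := _ + _) (by positivity)]
        refine mul_le_mul_of_nonneg_right ?_ (by positivity)
        rw [inner_sub_right]
        exact abs_norm_sub_norm_le _ _
    _ ≤ ‖x - y‖ * (‖x‖ + ‖y‖) := by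
        rw [Finset.sum_add_distrib, mul_add]
        exact add_le_add (cs x) (cs y)

theorem l1Le_norm_sq (x : H) : L1Le (fun k => ‖inner ℂ (ψ k) x‖ ^ 2) (‖x‖ ^ 2) := by
  simpa [sq] using l1Le_norm_sq_sub ψ x 0

theorem hasSum_norm_sq (x : H) : HasSum (fun k => ‖inner ℂ (ψ k) x‖ ^ 2) (‖x‖ ^ 2) := by
  have h := ψ.hasSum_inner_mul_inner x x
  have h2 := (Complex.hasSum_re h)
  rw [inner_self_eq_norm_sq_to_K] at h2
  convert h2 using 1
  · ext k
    rw [← inner_conj_symm x, mul_comm, Complex.mul_conj, Complex.normSq_eq_norm_sq,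
      Complex.ofReal_re]
  · norm_cast

/-- The unitary operator multiplying the `k`-th coordinate by `e^{iθ_k}`. -/
def phase [CompleteSpace H] (θ : ι → ℝ) : H ≃ₗᵢ[ℂ] H :=
  ψ.repr.trans (HilbertBasis.mk (orthonormal_phase ψ θ) (top_le_span_phase ψ θ)).repr.symm

variable [CompleteSpace H]

theorem inner_phase (θ : ι → ℝ) (k : ι) (x : H) :
    inner ℂ (ψ k) (phase ψ θ x) = Complex.exp (Complex.I * θ k) * inner ℂ (ψ k) x := by
  set ψ' := HilbertBasis.mk (orthonormal_phase ψ θ) (top_le_span_phase ψ θ) with hψ'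
  have h1 : ψ'.repr (phase ψ θ x) = ψ.repr x := by simp [phase, hψ']
  have h2 : inner ℂ (ψ' k) (phase ψ θ x) = inner ℂ (ψ k) x := by
    rw [← ψ'.repr_apply_apply, h1, ψ.repr_apply_apply]
  rw [hψ', HilbertBasis.coe_mk, inner_smul_left, conj_exp_I_mul] at h2
  rw [← h2, ← mul_assoc, exp_I_mul_mul_exp]
  simp

attribute [irreducible] phase

theorem norm_inner_phase (θ : ι → ℝ) (k : ι) (x : H) :
    ‖inner ℂ (ψ k) (phase ψ θ x)‖ = ‖inner ℂ (ψ k) x‖ := by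
  rw [inner_phase, norm_mul, norm_exp_I_mul, one_mul]

theorem phase_phase (θ θ' : ι → ℝ) (x : H) :
    phase ψ θ (phase ψ θ' x) = phase ψ (fun k => θ k + θ' k) x :=
  ext_inner_basis ψ fun k => by
    rw [inner_phase, inner_phase, inner_phase, ← mul_assoc, exp_I_mul_mul_exp]

theorem phase_eq_self {θ : ι → ℝ} (hθ : ∀ k, θ k = 0) (x : H) : phase ψ θ x = x :=
  ext_inner_basis ψ fun k => by simp [inner_phase, hθ]

theorem phase_apply_basis (θ : ι → ℝ) (k : ι) :
    phase ψ θ (ψ k) = Complex.exp (Complex.I * θ k) • ψ k :=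
  ext_inner_basis ψ fun j => by
    rw [inner_phase, inner_smul_right]
    by_cases h : j = k
    · rw [h]
    · rw [ψ.orthonormal.2 h]; simp

variable (ev : ι → ℝ)

/-- The unitary group `e^{itH₀}` of the diagonal operator with eigenvalues `ev`. -/
def flow (t : ℝ) : H ≃ₗᵢ[ℂ] H := phase ψ fun k => t * ev k

theorem inner_flow (t : ℝ) (k : ι) (x : H) :
    inner ℂ (ψ k) (flow ψ ev t x) = Complex.exp (Complex.I * (t * ev k : ℝ)) * inner ℂ (ψ k) x :=
  inner_phase ψ _ k x

theorem norm_inner_flow (t : ℝ) (k : ι) (x : H) :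
    ‖inner ℂ (ψ k) (flow ψ ev t x)‖ = ‖inner ℂ (ψ k) x‖ :=
  norm_inner_phase ψ _ k x

theorem flow_flow (s t : ℝ) (x : H) :
    flow ψ ev s (flow ψ ev t x) = flow ψ ev (s + t) x := by
  rw [flow, flow, phase_phase, flow]
  simp only [add_mul]

theorem flow_zero (x : H) : flow ψ ev 0 x = x := phase_eq_self ψ (by simp) x

theorem flow_neg_flow (t : ℝ) (x : H) : flow ψ ev (-t) (flow ψ ev t x) = x := by
  rw [flow_flow]; simp [flow_zero]

/-- On the dense span of the basis the orbits are explicit. Since all flow maps are isometries,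
continuity in time extends to joint continuity on the whole space. -/
theorem continuous_flow : Continuous fun p : ℝ × H => flow ψ ev p.1 p.2 := by
  have hd : Dense (Submodule.span ℂ (Set.range ψ) : Set H) := by
    rw [Submodule.dense_iff_topologicalClosure_eq_top]
    exact ψ.dense_span
  suffices h : Continuous fun p : H × ℝ => flow ψ ev p.2 p.1 from h.comp continuous_swap
  refine continuous_prod_of_dense_continuous_lipschitzWith _ 1 hd (fun x hx => ?_)
    fun t => (flow ψ ev t).lipschitz
  · induction hx using Submodule.span_induction with
    | mem x hx =>
      obtain ⟨k, rfl⟩ := hx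
      simp only [flow, phase_apply_basis]
      fun_prop
    | zero => simpa using continuous_const
    | add x y _ _ hx hy => simp only [map_add]; exact hx.add hy
    | smul a x _ hx => simp only [map_smul]; exact hx.const_smul a

variable (β : H →L[ℂ] H)

/-- The coupling operator in the interaction picture. -/
def coupling (s : ℝ) : H →L[ℂ] H :=
  ((flow ψ ev s).toContinuousLinearEquiv : H →L[ℂ] H) ∘L β ∘L
    ((flow ψ ev (-s)).toContinuousLinearEquiv : H →L[ℂ] H)

theorem coupling_apply (s : ℝ) (x : H) :
    coupling ψ ev β s x = flow ψ ev s (β (flow ψ ev (-s) x)) := rfl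

theorem continuous_coupling : Continuous fun p : ℝ × H => coupling ψ ev β p.1 p.2 := by
  have h1 : Continuous fun p : ℝ × H => flow ψ ev (-p.1) p.2 :=
    (continuous_flow ψ ev).comp (continuous_fst.neg.prodMk continuous_snd)
  exact (continuous_flow ψ ev).comp (continuous_fst.prodMk (β.continuous.comp h1))

theorem norm_coupling_le (hβ : ‖β‖ ≤ 1) (s : ℝ) (x : H) : ‖coupling ψ ev β s x‖ ≤ ‖x‖ := by
  refine ((flow ψ ev s).norm_map _).trans_le ((β.le_opNorm _).trans ?_)
  exact (mul_le_of_le_one_left (norm_nonneg _) hβ).trans_eq ((flow ψ ev (-s)).norm_map x)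

theorem im_inner_coupling (hβ : IsSelfAdjoint β) (s : ℝ) (x : H) :
    (inner ℂ x (coupling ψ ev β s x)).im = 0 := by
  rw [coupling_apply, ← (flow ψ ev (-s)).inner_map_map, flow_neg_flow]
  set y := flow ψ ev (-s) x
  have h := (ContinuousLinearMap.isSelfAdjoint_iff_isSymmetric.1 hβ) y y
  have h2 : (starRingEnd ℂ) (inner ℂ y (β y)) = inner ℂ y (β y) := by
    rw [inner_conj_symm]; exact h
  exact Complex.conj_eq_iff_im.1 h2

theorem inner_coupling_basis (s : ℝ) (k j : ι) :
    inner ℂ (ψ k) (coupling ψ ev β s (ψ j)) =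
      Complex.exp (Complex.I * (s * (ev k - ev j) : ℝ)) * inner ℂ (ψ k) (β (ψ j)) := by
  rw [coupling_apply, inner_flow, flow, phase_apply_basis, map_smul, inner_smul_right, ← mul_assoc,
    exp_I_mul_mul_exp]
  congr 4; ring

end Phase

/-! ### Existence of the propagator by inverting a Volterra equation. -/

section Propagator

open scoped BoundedContinuousFunction

variable {H : Type*} [NormedAddCommGroup H] [InnerProductSpace ℂ H]
  {b : ℝ → H →L[ℂ] H} {g : ℝ → ℝ}

theorem intervalIntegrable_smul_apply (hbc : Continuous fun p : ℝ × H => b p.1 p.2)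
    {p q : ℝ} (hg : IntervalIntegrable g volume p q) (c : ℂ) {u : ℝ → H}
    (hu : ContinuousOn u (Set.uIcc p q)) :
    IntervalIntegrable (fun s => (c * (g s : ℂ)) • b s (u s)) volume p q := by
  have h1 : ContinuousOn (fun s => b s (u s)) (Set.uIcc p q) :=
    hbc.comp_continuousOn (continuousOn_id.prodMk hu)
  have h2 : IntervalIntegrable (fun s => c * (g s : ℂ)) volume p q := by
    refine IntervalIntegrable.const_mul ?_ c
    exact ⟨hg.1.ofReal, hg.2.ofReal⟩
  exact h2.smul_continuousOn h1

theorem norm_integral_le_of_norm_le_mul {f : ℝ → H} (hg : Integrable g) {C : ℝ} {p q : ℝ}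
    (hC : ∀ s ∈ Set.uIoc p q, ‖f s‖ ≤ |g s| * C) (hC0 : 0 ≤ C) :
    ‖∫ s in p..q, f s‖ ≤ (∫ s, |g s|) * C := by
  calc ‖∫ s in p..q, f s‖ ≤ ∫ s in Set.uIoc p q, |g s| * C := by
        refine intervalIntegral.norm_integral_le_integral_norm_uIoc.trans ?_
        refine integral_mono_of_nonneg (Filter.Eventually.of_forall fun _ => norm_nonneg _)
          ((hg.abs.mul_const C).integrableOn) ?_
        filter_upwards [ae_restrict_mem measurableSet_uIoc] with s hs using hC s hs
    _ ≤ ∫ s, |g s| * C := setIntegral_le_integral (hg.abs.mul_const C)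
        (Filter.Eventually.of_forall fun _ => by positivity)
    _ = (∫ s, |g s|) * C := integral_mul_const _ _

theorem norm_integral_smul_apply_le (hb : ∀ s x, ‖b s x‖ ≤ ‖x‖) (hg : Integrable g)
    (u : ℝ →ᵇ H) (t : ℝ) :
    ‖∫ s in (0 : ℝ)..t, (1 * (g s : ℂ)) • b s (u s)‖ ≤ (∫ s, |g s|) * ‖u‖ :=
  norm_integral_le_of_norm_le_mul hg (fun s _ => by
    rw [norm_smul]
    simpa using mul_le_mul_of_nonneg_left ((hb s (u s)).trans (u.norm_coe_le_norm s))
      (abs_nonneg (g s))) (norm_nonneg _)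

/-- The Volterra operator `(Ku)(t) = ∫₀ᵗ g(s) b(s) u(s) ds` on bounded continuous functions. -/
def volterra (hbc : Continuous fun p : ℝ × H => b p.1 p.2) (hb : ∀ s x, ‖b s x‖ ≤ ‖x‖)
    (hg : Integrable g) : (ℝ →ᵇ H) →L[ℂ] (ℝ →ᵇ H) :=
  LinearMap.mkContinuous
    { toFun := fun u => BoundedContinuousFunction.ofNormedAddCommGroup
        (fun t => ∫ s in (0 : ℝ)..t, (1 * (g s : ℂ)) • b s (u s))
        (intervalIntegral.continuous_primitive (fun p q =>
          intervalIntegrable_smul_apply hbc hg.intervalIntegrable 1 u.continuous.continuousOn) 0)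
        ((∫ s, |g s|) * ‖u‖)
        (norm_integral_smul_apply_le hb hg u)
      map_add' := fun u v => by
        ext t
        have hi : ∀ w : ℝ →ᵇ H, IntervalIntegrable (fun s => (1 * (g s : ℂ)) • b s (w s))
            volume 0 t := fun w =>
          intervalIntegrable_smul_apply hbc hg.intervalIntegrable 1 w.continuous.continuousOn
        simp only [BoundedContinuousFunction.coe_ofNormedAddCommGroup,
          BoundedContinuousFunction.coe_add, Pi.add_apply, map_add, smul_add]
        exact intervalIntegral.integral_add (hi u) (hi v)
      map_smul' := fun c u => by
        ext t
        simp only [BoundedContinuousFunction.coe_ofNormedAddCommGroup,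
          BoundedContinuousFunction.coe_smul, map_smul, RingHom.id_apply]
        rw [← intervalIntegral.integral_smul]
        simp only [smul_comm c] }
    (∫ s, |g s|) (fun u => BoundedContinuousFunction.norm_ofNormedAddCommGroup_le _
      (mul_nonneg (integral_nonneg fun _ => abs_nonneg _) (norm_nonneg _))
      (norm_integral_smul_apply_le hb hg u))

theorem volterra_apply (hbc : Continuous fun p : ℝ × H => b p.1 p.2)
    (hb : ∀ s x, ‖b s x‖ ≤ ‖x‖) (hg : Integrable g) (u : ℝ →ᵇ H) (t : ℝ) :
    volterra hbc hb hg u t = ∫ s in (0 : ℝ)..t, (1 * (g s : ℂ)) • b s (u s) := rfl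

theorem integral_mul_primitive {h : ℝ → ℝ} {t : ℝ} (hh : IntervalIntegrable h volume 0 t) :
    ∫ s in (0 : ℝ)..t, h s * ∫ r in (0 : ℝ)..s, h r = (∫ s in (0 : ℝ)..t, h s) ^ 2 / 2 := by
  have hac := absolutelyContinuous_integral hh
  have hi : IntervalIntegrable (fun s => h s * ∫ r in (0 : ℝ)..s, h r) volume 0 t :=
    hh.mul_continuousOn hac.continuousOn
  have key := eq_add_integral_of_ae_hasDerivAt (hac.fun_mul hac) (hi.const_mul 2) (by
    filter_upwards [hh.ae_hasDerivAt_integral] with x hx hxm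
    have h1 := hx hxm 0 Set.left_mem_uIcc
    refine (h1.mul h1).congr_deriv ?_
    ring)
  rw [intervalIntegral.integral_const_mul] at key
  simp only [intervalIntegral.integral_same] at key
  linarith

/-- The bound `‖K‖ ≤ 1` alone would not give a Neumann series when |ε| = 1. Time ordering improves
the second iterate by the factor 1/2!, obtained from `integral_mul_primitive`. -/
theorem norm_volterra_sq_le (hbc : Continuous fun p : ℝ × H => b p.1 p.2)
    (hb : ∀ s x, ‖b s x‖ ≤ ‖x‖) (hg : Integrable g) (hg0 : ∀ s, s < 0 → g s = 0)
    (hg1 : ∫ s, |g s| ≤ 1) : ‖volterra hbc hb hg * volterra hbc hb hg‖ ≤ 1 / 2 := by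
  refine ContinuousLinearMap.opNorm_le_bound _ (by norm_num) fun u => ?_
  refine (BoundedContinuousFunction.norm_le (by positivity)).2 fun t => ?_
  rw [mul_apply_eq_comp, volterra_apply]
  set v := volterra hbc hb hg u with hv
  rcases lt_or_ge t 0 with ht | ht
  · rw [intervalIntegral.integral_zero_ae]
    · simp
    -- For negative `t` the integrand vanishes except perhaps at 0, where `g` is not controlled.
    · have : ∀ᵐ s : ℝ, s ≠ 0 := by simp [ae_iff, measure_singleton]
      filter_upwards [this] with s hs hsm
      rw [Set.uIoc_of_ge ht.le] at hsm
      simp [hg0 s (lt_of_le_of_ne hsm.2 hs)]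
  · have hga : ∀ p q, IntervalIntegrable (fun s => |g s|) volume p q := fun p q =>
      hg.abs.intervalIntegrable
    have hvb : ∀ s, 0 ≤ s → ‖v s‖ ≤ (∫ r in (0 : ℝ)..s, |g r|) * ‖u‖ := by
      intro s hs
      rw [hv, volterra_apply, ← intervalIntegral.integral_mul_const]
      refine intervalIntegral.norm_integral_le_of_norm_le hs ?_ ((hga 0 s).mul_const _)
      refine Filter.Eventually.of_forall fun r _ => ?_
      rw [norm_smul]
      simpa using mul_le_mul_of_nonneg_left ((hb r (u r)).trans (u.norm_coe_le_norm r))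
        (abs_nonneg (g r))
    have hint : IntervalIntegrable (fun s => |g s| * ∫ r in (0 : ℝ)..s, |g r|) volume 0 t :=
      (hga 0 t).mul_continuousOn (absolutelyContinuous_integral (hga 0 t)).continuousOn
    calc ‖∫ s in (0 : ℝ)..t, (1 * (g s : ℂ)) • b s (v s)‖
        ≤ ∫ s in (0 : ℝ)..t, (|g s| * ∫ r in (0 : ℝ)..s, |g r|) * ‖u‖ := by
          refine intervalIntegral.norm_integral_le_of_norm_le ht ?_ (hint.mul_const _)
          refine Filter.Eventually.of_forall fun s hs => ?_
          rw [norm_smul, mul_assoc]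
          simpa using mul_le_mul_of_nonneg_left ((hb s (v s)).trans (hvb s hs.1.le))
            (abs_nonneg (g s))
      _ = (∫ s in (0 : ℝ)..t, |g s|) ^ 2 / 2 * ‖u‖ := by
          rw [intervalIntegral.integral_mul_const, integral_mul_primitive (hga 0 t)]
      _ ≤ 1 / 2 * ‖u‖ := by
          refine mul_le_mul_of_nonneg_right ?_ (norm_nonneg _)
          have h0 : 0 ≤ ∫ s in (0 : ℝ)..t, |g s| :=
            intervalIntegral.integral_nonneg ht fun _ _ => abs_nonneg _
          have h1 : ∫ s in (0 : ℝ)..t, |g s| ≤ 1 := by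
            rw [intervalIntegral.integral_of_le ht]
            exact (setIntegral_le_integral hg.abs
              (Filter.Eventually.of_forall fun _ => abs_nonneg _)).trans hg1
          have := pow_le_one₀ (n := 2) h0 h1
          linarith

/-- With X = cK, the operator 1 - X² = (1 - X)(1 + X) is invertible and the factors commute, so each
factor is invertible. -/
theorem isUnit_one_sub_smul {E : Type*} [NormedAddCommGroup E] [NormedSpace ℂ E] [CompleteSpace E]
    {K : E →L[ℂ] E} (hK : ‖K * K‖ ≤ 1 / 2) {c : ℂ} (hc : ‖c‖ ≤ 1) : IsUnit (1 - c • K) := by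
  set X := c • K with hX
  have hXX : ‖X * X‖ < 1 := by
    rw [hX, smul_mul_smul_comm, norm_smul, norm_mul]
    calc _ ≤ 1 * (1 / 2 : ℝ) :=
          mul_le_mul (mul_le_one₀ hc (norm_nonneg _) hc) hK (norm_nonneg _) zero_le_one
      _ < 1 := by norm_num
  have h1 : IsUnit (1 - X * X) := isUnit_one_sub_of_norm_lt_one hXX
  have hcomm : Commute (1 - X) (1 + X) := by
    simp only [Commute, SemiconjBy, mul_add, add_mul, mul_sub, sub_mul, one_mul, mul_one]
    abel
  have he : (1 - X) * (1 + X) = 1 - X * X := by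
    simp only [mul_add, sub_mul, one_mul, mul_one]
    abel
  rw [← he] at h1
  exact (hcomm.isUnit_mul_iff.1 h1).1

/-- Existence of the propagator of `w' = -iε g(t) b(t) w`. -/
theorem exists_propagator [CompleteSpace H] (hbc : Continuous fun p : ℝ × H => b p.1 p.2)
    (hb : ∀ s x, ‖b s x‖ ≤ ‖x‖) (hg : Integrable g) (hg0 : ∀ s, s < 0 → g s = 0)
    (hg1 : ∫ s, |g s| ≤ 1) {ε : ℝ} (hε : |ε| ≤ 1) :
    ∃ S : ℝ → H →L[ℂ] H, (∀ x, Continuous fun r => S r x) ∧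
      ∀ x r, S r x = x + ∫ s in (0 : ℝ)..r, (-Complex.I * ε * (g s : ℂ)) • b s (S s x) := by
  set K := volterra hbc hb hg with hK
  set X : (ℝ →ᵇ H) →L[ℂ] (ℝ →ᵇ H) := (-Complex.I * ε) • K with hX
  have hunit : IsUnit (1 - X) :=
    isUnit_one_sub_smul (norm_volterra_sq_le hbc hb hg hg0 hg1) (by simpa using hε)
  obtain ⟨U, hU⟩ := hunit
  let cst : H →L[ℂ] (ℝ →ᵇ H) := LinearMap.mkContinuous
    { toFun := fun x => BoundedContinuousFunction.const ℝ x
      map_add' := fun x y => by ext; simp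
      map_smul' := fun c x => by ext; simp } 1 (fun x => by
        simp)
  let R : (ℝ →ᵇ H) →L[ℂ] (ℝ →ᵇ H) := ((U⁻¹ : ((ℝ →ᵇ H) →L[ℂ] (ℝ →ᵇ H))ˣ) : _)
  -- The trajectory from `x` is (1 - X)⁻¹ applied to the constant function `x`. Evaluating it at `r`
  -- is linear and bounded in `x`.
  refine ⟨fun r => (BoundedContinuousFunction.evalCLM ℂ r) ∘L R ∘L cst, fun x => ?_, fun x r => ?_⟩
  · exact (R (cst x)).continuous
  · have h1 : (1 - X) (R (cst x)) = cst x := by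
      rw [← hU]
      change ((U : (ℝ →ᵇ H) →L[ℂ] (ℝ →ᵇ H)) * R) (cst x) = cst x
      simp [R]
    have h2 : R (cst x) = cst x + X (R (cst x)) := by
      nth_rewrite 2 [← h1]
      rw [sub_apply, one_apply_eq_self, sub_add_cancel]
    have h3 := congrArg (fun u : ℝ →ᵇ H => u r) h2
    change R (cst x) r = x + ∫ s in (0 : ℝ)..r, (-Complex.I * ε * (g s : ℂ)) • b s (R (cst x) s)
    refine h3.trans ?_
    change x + (-Complex.I * ε) • (K (R (cst x)) r) = _
    rw [hK, volterra_apply, ← intervalIntegral.integral_smul]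
    simp only [smul_smul, one_mul]

end Propagator

/-! ### Unitarity, small-ε expansion and uniqueness for a single defect. -/

section IsPropagator

variable {H : Type*} [NormedAddCommGroup H] [InnerProductSpace ℂ H]

/-- `S` is the propagator of `w' = -iε g(t) b(t) w` started at time `0`. -/
structure IsPropagator (b : ℝ → H →L[ℂ] H) (g : ℝ → ℝ) (ε : ℝ) (S : ℝ → H →L[ℂ] H) : Prop where
  cont : ∀ x, Continuous fun r => S r x
  eqn : ∀ x r, S r x = x + ∫ s in (0 : ℝ)..r, (-Complex.I * ε * (g s : ℂ)) • b s (S s x)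

/-- Standing assumptions on the coupling and the profile of a defect of length `T`. -/
structure IsDefect (b : ℝ → H →L[ℂ] H) (g : ℝ → ℝ) (T : ℝ) : Prop where
  cont : Continuous fun p : ℝ × H => b p.1 p.2
  bound : ∀ s x, ‖b s x‖ ≤ ‖x‖
  symm : ∀ s x, (inner ℂ x (b s x)).im = 0
  int : Integrable g
  supp : Function.support g ⊆ Set.Icc 0 T
  int_le : ∫ s, |g s| ≤ 1
  pos : 0 < T

variable {b : ℝ → H →L[ℂ] H} {g : ℝ → ℝ} {T ε : ℝ} {S : ℝ → H →L[ℂ] H}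

theorem IsDefect.eq_zero_of_neg (hD : IsDefect b g T) {s : ℝ} (hs : s < 0) : g s = 0 := by
  by_contra h
  exact absurd (hD.supp h).1 (not_le.2 hs)

theorem IsDefect.exists_propagator [CompleteSpace H] (hD : IsDefect b g T) (hε : |ε| ≤ 1) :
    ∃ S, IsPropagator b g ε S := by
  obtain ⟨S, h1, h2⟩ := RandomDefects.exists_propagator hD.cont hD.bound hD.int
    (fun s => hD.eq_zero_of_neg) hD.int_le hε
  exact ⟨S, h1, h2⟩

theorem IsDefect.integrand (hD : IsDefect b g T) (c : ℂ) {p q : ℝ} {u : ℝ → H}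
    (hu : ContinuousOn u (Set.uIcc p q)) :
    IntervalIntegrable (fun s => (c * (g s : ℂ)) • b s (u s)) volume p q :=
  intervalIntegrable_smul_apply hD.cont hD.int.intervalIntegrable c hu

theorem re_inner_skew (hs : ∀ s x, (inner ℂ x (b s x)).im = 0) (s r : ℝ) (x : H) :
    (inner ℂ x ((-Complex.I * ε * (r : ℂ)) • b s x)).re = 0 := by
  rw [inner_smul_right]
  simp [Complex.mul_re, hs s x]

theorem IsDefect.integral_eq_zero (hD : IsDefect b g T) (c : ℂ) {p : ℝ} (hp : p ≤ 0) (u : ℝ → H) :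
    ∫ s in p..(0 : ℝ), (c * (g s : ℂ)) • b s (u s) = 0 := by
  refine intervalIntegral.integral_zero_ae ?_
  have : ∀ᵐ s : ℝ, s ≠ 0 := by simp [ae_iff, measure_singleton]
  filter_upwards [this] with s hs hsm
  rw [Set.uIoc_of_le hp] at hsm
  simp [hD.eq_zero_of_neg (lt_of_le_of_ne hsm.2 hs)]

/-- Nothing happens before the onset. This lets a solution be started at time `-d`, the beginning of
the waiting period. -/
theorem IsPropagator.apply_of_nonpos (hS : IsPropagator b g ε S) (hD : IsDefect b g T) {r : ℝ}
    (hr : r ≤ 0) (x : H) : S r x = x := by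
  rw [hS.eqn, intervalIntegral.integral_symm, hD.integral_eq_zero _ hr]
  simp

theorem IsDefect.norm_integral_le (hD : IsDefect b g T) (x : H) :
    ‖∫ s in (0 : ℝ)..T, (1 * (g s : ℂ)) • b s x‖ ≤ ‖x‖ := by
  refine (norm_integral_le_of_norm_le_mul (C := ‖x‖) hD.int (fun s _ => ?_)
    (by positivity)).trans (mul_le_of_le_one_left (by positivity) hD.int_le)
  rw [norm_smul]
  simpa using mul_le_mul_of_nonneg_left (hD.bound s x) (abs_nonneg (g s))

variable [CompleteSpace H]

theorem IsPropagator.norm_apply (hS : IsPropagator b g ε S) (hD : IsDefect b g T) (r : ℝ) (x : H) :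
    ‖S r x‖ = ‖x‖ := by
  have e0 : S 0 x = x := by rw [hS.eqn]; simp
  have := norm_eq_of_re_inner_eq_zero (v := fun r => S r x) (a := 0) (b := r)
    (hD.integrand _ (hS.cont x).continuousOn)
    (fun r' _ => by rw [e0]; exact hS.eqn x r') (fun s _ => re_inner_skew hD.symm _ _ _)
  rwa [e0] at this

theorem IsPropagator.continuous (hS : IsPropagator b g ε S) (hD : IsDefect b g T) :
    Continuous fun p : ℝ × H => S p.1 p.2 := by
  suffices h : Continuous fun p : H × ℝ => S p.2 p.1 from h.comp continuous_swap
  refine continuous_prod_of_continuous_lipschitzWith _ 1 hS.cont fun r => ?_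
  refine LipschitzWith.of_dist_le_mul fun x y => ?_
  simp only [dist_eq_norm, ← map_sub, hS.norm_apply hD]
  simp

theorem IsPropagator.norm_sub_le (hS : IsPropagator b g ε S) (hD : IsDefect b g T) (r r' : ℝ)
    (x : H) : ‖S r x - S r' x‖ ≤ |ε| * ‖x‖ := by
  have hi : ∀ p q, IntervalIntegrable (fun s => (-Complex.I * ε * (g s : ℂ)) • b s (S s x))
    volume p q := fun p q => hD.integrand _ (hS.cont x).continuousOn
  rw [hS.eqn x r, hS.eqn x r', add_sub_add_left_eq_sub,
    intervalIntegral.integral_interval_sub_left (hi _ _) (hi _ _)]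
  refine (norm_integral_le_of_norm_le_mul (C := |ε| * ‖x‖) hD.int (fun s _ => ?_)
    (by positivity)).trans (mul_le_of_le_one_left (by positivity) hD.int_le)
  rw [norm_smul]
  simp only [norm_mul, norm_neg, Complex.norm_I, one_mul, Complex.norm_real, Real.norm_eq_abs]
  calc |ε| * |g s| * ‖b s (S s x)‖ ≤ |ε| * |g s| * ‖x‖ := by
        gcongr
        exact (hD.bound _ _).trans_eq (hS.norm_apply hD _ _)
    _ = |g s| * (|ε| * ‖x‖) := by ring

/-- First order expansion of the propagator. -/
theorem IsPropagator.norm_sub_first_order_le (hS : IsPropagator b g ε S) (hD : IsDefect b g T)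
    (x : H) :
    ‖S T x - (x + (-Complex.I * ε) • ∫ s in (0 : ℝ)..T, (1 * (g s : ℂ)) • b s x)‖ ≤
      ε ^ 2 * ‖x‖ := by
  have e : S T x - (x + (-Complex.I * ε) • ∫ s in (0 : ℝ)..T, (1 * (g s : ℂ)) • b s x) =
      ∫ s in (0 : ℝ)..T, (-Complex.I * ε * (g s : ℂ)) • b s (S s x - S 0 x) := by
    have e0 : S 0 x = x := hS.apply_of_nonpos hD le_rfl x
    have hi : IntervalIntegrable
        (fun s => (-Complex.I * ε) • (1 * (g s : ℂ)) • b s x) volume 0 T :=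
      (hD.integrand 1 continuousOn_const).smul _
    rw [hS.eqn, add_sub_add_left_eq_sub, ← intervalIntegral.integral_smul,
      ← intervalIntegral.integral_sub (hD.integrand _ (hS.cont x).continuousOn) hi]
    congr 1
    ext s
    rw [e0, map_sub, smul_sub, smul_smul, one_mul]
  rw [e]
  refine (norm_integral_le_of_norm_le_mul (C := ε ^ 2 * ‖x‖) hD.int (fun s _ => ?_)
    (by positivity)).trans (mul_le_of_le_one_left (by positivity) hD.int_le)
  rw [norm_smul]
  simp only [norm_mul, norm_neg, Complex.norm_I, one_mul, Complex.norm_real, Real.norm_eq_abs]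
  calc |ε| * |g s| * ‖b s (S s x - S 0 x)‖ ≤ |ε| * |g s| * (|ε| * ‖x‖) := by
        gcongr
        exact (hD.bound _ _).trans (hS.norm_sub_le hD _ _ _)
    _ = |g s| * (ε ^ 2 * ‖x‖) := by rw [← sq_abs ε]; ring

/-- Any solution on an interval around `0` is given by the propagator. -/
theorem IsPropagator.eq_of_solution (hS : IsPropagator b g ε S) (hD : IsDefect b g T) {p q : ℝ}
    (hp : p ≤ 0) {v : ℝ → H} (hvc : ContinuousOn v (Set.Icc p q))
    (hv : ∀ r ∈ Set.Icc p q,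
      v r = v p + ∫ s in p..r, (-Complex.I * ε * (g s : ℂ)) • b s (v s))
    {r : ℝ} (hr : r ∈ Set.Icc p q) : v r = S r (v p) := by
  have hsub : ∀ {t}, t ∈ Set.Icc p r → Set.uIcc p t ⊆ Set.Icc p q := fun {t} ht => by
    rw [Set.uIcc_of_le ht.1]
    exact Set.Icc_subset_Icc_right (ht.2.trans hr.2)
  -- The difference of two solutions solves the same linear equation from zero, and conservation of
  -- norm keeps it zero.
  have hpr := hsub (Set.right_mem_Icc.2 hr.1)
  set z : ℝ → H := fun t => v t - S t (v p) with hz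
  have hzc : ContinuousOn z (Set.uIcc p r) := (hvc.mono hpr).sub (hS.cont _).continuousOn
  have hz0 : z p = 0 := by simp [hz, hS.apply_of_nonpos hD hp]
  have hzeq : ∀ t ∈ Set.uIcc p r,
      z t = z p + ∫ s in p..t, (-Complex.I * ε * (g s : ℂ)) • b s (z s) := by
    intro t ht
    rw [Set.uIcc_of_le hr.1] at ht
    have h1 := hv t ⟨ht.1, ht.2.trans hr.2⟩
    have hi : ∀ p' q', IntervalIntegrable
      (fun s => (-Complex.I * ε * (g s : ℂ)) • b s (S s (v p))) volume p' q' :=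
      fun p' q' => hD.integrand _ (hS.cont _).continuousOn
    have h2 : S t (v p) = v p + ∫ s in p..t, (-Complex.I * ε * (g s : ℂ)) • b s (S s (v p)) := by
      rw [hS.eqn, ← intervalIntegral.integral_add_adjacent_intervals (hi p 0) (hi 0 t),
        hD.integral_eq_zero _ hp, zero_add]
    rw [hz0, zero_add]
    change v t - S t (v p) = _
    rw [h1, h2, add_sub_add_left_eq_sub,
      ← intervalIntegral.integral_sub (hD.integrand _ (hvc.mono (hsub ht))) (hi _ _)]
    simp only [hz, map_sub, smul_sub]
  have hn := norm_eq_of_re_inner_eq_zero (hD.integrand _ hzc) hzeq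
    (fun s _ => re_inner_skew hD.symm _ _ _)
  rw [hz0, norm_zero, norm_eq_zero] at hn
  exact sub_eq_zero.1 hn

end IsPropagator

/-! ### Deterministic geometry of the train of defects. -/

section Train

/-- End time of the `n`-th defect (counted from one). -/
def defectEnd (T : ℝ) (d : ℕ → ℝ) (n : ℕ) : ℝ := ∑ i ∈ Finset.range n, (d i + T)

variable {T : ℝ} {d : ℕ → ℝ}

theorem onset_eq (n : ℕ) : onset T d n = defectEnd T d n + d n := rfl

theorem defectEnd_succ (n : ℕ) : defectEnd T d (n + 1) = onset T d n + T := by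
  rw [onset_eq, defectEnd, Finset.sum_range_succ, defectEnd]; ring

theorem defectEnd_zero : defectEnd T d 0 = 0 := by simp [defectEnd]

theorem defectEnd_mono (hT : 0 < T) (hd : ∀ i, 0 ≤ d i) : Monotone (defectEnd T d) :=
  monotone_nat_of_le_succ fun n => by
    rw [defectEnd_succ, onset_eq]; linarith [hd n]

theorem mul_le_defectEnd (hd : ∀ i, 0 ≤ d i) (n : ℕ) : n * T ≤ defectEnd T d n := by
  induction n with
  | zero => simp [defectEnd]
  | succ n ih => rw [defectEnd_succ, onset_eq]; push_cast; linarith [hd n]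

theorem train_eq {g₀ : ℝ → ℝ} (hsupp : Function.support g₀ ⊆ Set.Icc 0 T) (hT : 0 < T)
    (hd : ∀ i, 0 ≤ d i) {i : ℕ} {s : ℝ}
    (hs : s ∈ Set.Ioo (defectEnd T d i) (defectEnd T d (i + 1))) :
    train T g₀ d s = g₀ (s - onset T d i) := by
  refine tsum_eq_single i fun j hj => ?_
  by_contra h
  have hm := hsupp h
  rcases lt_or_gt_of_ne hj with hji | hji
  · have := defectEnd_mono hT hd (Nat.succ_le_of_lt hji)
    rw [Nat.succ_eq_add_one, defectEnd_succ] at this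
    linarith [hm.2, hs.1]
  · have := defectEnd_mono hT hd (Nat.succ_le_of_lt hji)
    rw [Nat.succ_eq_add_one] at this
    have h2 := onset_eq (T := T) (d := d) j
    linarith [hm.1, hs.2, hd j]

/-- Endpoints are discarded: with zero waiting time two consecutive defects both contribute at their
common endpoint. -/
theorem ae_train_eq {g₀ : ℝ → ℝ} (hsupp : Function.support g₀ ⊆ Set.Icc 0 T) (hT : 0 < T)
    (hd : ∀ i, 0 ≤ d i) (i : ℕ) : ∀ᵐ s : ℝ,
      s ∈ Set.Icc (defectEnd T d i) (defectEnd T d (i + 1)) →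
        train T g₀ d s = g₀ (s - onset T d i) := by
  have h1 : ∀ᵐ s : ℝ, s ≠ defectEnd T d i := by simp [ae_iff, measure_singleton]
  have h2 : ∀ᵐ s : ℝ, s ≠ defectEnd T d (i + 1) := by simp [ae_iff, measure_singleton]
  filter_upwards [h1, h2] with s h1 h2 hs
  exact train_eq hsupp hT hd ⟨lt_of_le_of_ne hs.1 (Ne.symm h1), lt_of_le_of_ne hs.2 h2⟩

theorem intervalIntegrable_train {g₀ : ℝ → ℝ} (hg : Integrable g₀)
    (hsupp : Function.support g₀ ⊆ Set.Icc 0 T) (hT : 0 < T) (hd : ∀ i, 0 ≤ d i) (t : ℝ)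
    (ht : 0 ≤ t) : IntervalIntegrable (train T g₀ d) volume 0 t := by
  have step : ∀ n, IntervalIntegrable (train T g₀ d) volume 0 (defectEnd T d n) := by
    intro n
    induction n with
    | zero => rw [defectEnd_zero]
    | succ n ih =>
      refine ih.trans ?_
      have h := (hg.comp_sub_right (onset T d n)).intervalIntegrable
        (a := defectEnd T d n) (b := defectEnd T d (n + 1))
      refine h.congr_ae ?_
      rw [Filter.EventuallyEq, ae_restrict_iff' measurableSet_uIoc]
      filter_upwards [ae_train_eq hsupp hT hd n] with s hs hsm
      rw [Set.uIoc_of_le (defectEnd_mono hT hd n.le_succ)] at hsm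
      exact (hs ⟨hsm.1.le, hsm.2⟩).symm
  obtain ⟨n, hn⟩ := exists_nat_gt (t / T)
  refine (step n).mono_set ?_
  have := mul_le_defectEnd (T := T) hd n
  rw [div_lt_iff₀ hT] at hn
  rw [Set.uIcc_of_le ht, Set.uIcc_of_le (ht.trans (hn.le.trans this))]
  exact Set.Icc_subset_Icc_right (hn.le.trans this)

theorem exists_defectEnd_le_lt (hT : 0 < T) (hd : ∀ i, 0 ≤ d i) {t : ℝ} (ht : 0 ≤ t) :
    ∃ i, defectEnd T d i ≤ t ∧ t < defectEnd T d (i + 1) := by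
  have hex : ∃ n, t < defectEnd T d n := by
    obtain ⟨n, hn⟩ := exists_nat_gt (t / T)
    rw [div_lt_iff₀ hT] at hn
    exact ⟨n, hn.trans_le (mul_le_defectEnd hd n)⟩
  classical
  have hs := Nat.find_spec hex
  have h0 : Nat.find hex ≠ 0 := by
    intro h
    rw [h, defectEnd_zero] at hs
    linarith
  obtain ⟨i, hi⟩ := Nat.exists_eq_succ_of_ne_zero h0
  refine ⟨i, not_lt.1 (Nat.find_min hex (by omega)), ?_⟩
  rwa [hi] at hs

end Train

/-! ### The solution along one realisation of the waiting times. -/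

section Pathwise

variable {H : Type*} [NormedAddCommGroup H] [InnerProductSpace ℂ H] {ι : Type*}
  {H₀ : H →ₗ.[ℂ] H} {ψ : HilbertBasis ι ℂ H} {ev : ι → ℝ} {β : H →L[ℂ] H} {ε : ℝ}

theorem IsSolution.apply_zero {g : ℝ → ℝ} {φ₀ : H} {φ : ℝ → H}
    (hφ : IsSolution H₀ β ε g φ₀ φ) (hdom : ∀ j, ψ j ∈ H₀.domain) : φ 0 = φ₀ :=
  ext_inner_basis ψ fun k => by simpa using hφ.2 0 le_rfl ⟨ψ k, hdom k⟩

variable [CompleteSpace H]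

theorem isDefect_coupling (hβ : IsSelfAdjoint β) (hβ1 : ‖β‖ = 1) {T : ℝ} {g₀ : ℝ → ℝ}
    (hg₀ : AEStronglyMeasurable g₀ volume) (hsupp : Function.support g₀ ⊆ Set.Icc 0 T)
    (hg₀1 : ∫ t, |g₀ t| = 1) : IsDefect (coupling ψ ev β) g₀ T where
  cont := continuous_coupling ψ ev β
  bound := norm_coupling_le ψ ev β hβ1.le
  symm := im_inner_coupling ψ ev β hβ
  int := by
    have h : Integrable fun t => |g₀ t| := by
      by_contra h
      rw [integral_undef h] at hg₀1
      exact zero_ne_one hg₀1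
    exact (integrable_norm_iff hg₀).1 h
  supp := hsupp
  int_le := hg₀1.le
  pos := by
    -- For `T ≤ 0` the profile would vanish off the null set {0}, contradicting its unit L¹ norm.
    by_contra hT
    have h0 : ∀ᵐ t : ℝ, |g₀ t| = 0 := by
      have : ∀ᵐ s : ℝ, s ≠ 0 := by simp [ae_iff, measure_singleton]
      filter_upwards [this] with s hs
      by_contra h
      have hm := hsupp (abs_ne_zero.1 h)
      exact hs (le_antisymm (hm.2.trans (not_lt.1 hT)) hm.1)
    rw [integral_congr_ae h0] at hg₀1
    simp at hg₀1

/-- The Schrödinger equation in the interaction picture. -/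
theorem IsSolution.interaction {g : ℝ → ℝ} {φ₀ : H} {φ : ℝ → H}
    (hφ : IsSolution H₀ β ε g φ₀ φ) (hdom : ∀ j, ψ j ∈ H₀.domain)
    (heig : ∀ j, H₀ ⟨ψ j, hdom j⟩ = (ev j : ℂ) • ψ j)
    (hg : ∀ t, 0 ≤ t → IntervalIntegrable g volume 0 t) {t : ℝ} (ht : 0 ≤ t) :
    flow ψ ev t (φ t) = φ₀ + ∫ s in (0 : ℝ)..t,
      (-Complex.I * ε * (g s : ℂ)) • coupling ψ ev β s (flow ψ ev s (φ s)) := by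
  have hc : ContinuousOn φ (Set.uIcc 0 t) := hφ.1.mono (by
    rw [Set.uIcc_of_le ht]; exact Set.Icc_subset_Ici_self)
  have hu : ContinuousOn (fun s => flow ψ ev s (φ s)) (Set.uIcc 0 t) :=
    (continuous_flow ψ ev).comp_continuousOn (continuousOn_id.prodMk hc)
  have hi := intervalIntegrable_smul_apply (continuous_coupling ψ ev β) (hg t ht)
    (-Complex.I * ε) hu
  refine ext_inner_basis ψ fun k => ?_
  have hyc : ContinuousOn (fun s => inner ℂ (ψ k) (φ s)) (Set.uIcc 0 t) :=
    continuousOn_const.inner hc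
  have hfi : IntervalIntegrable
      (fun s => (ε : ℂ) * (g s : ℂ) * inner ℂ (ψ k) (β (φ s))) volume 0 t := by
    have h2 : IntervalIntegrable (fun s => (ε : ℂ) * (g s : ℂ)) volume 0 t :=
      IntervalIntegrable.const_mul ⟨(hg t ht).1.ofReal, (hg t ht).2.ofReal⟩ _
    exact h2.mul_continuousOn (continuousOn_const.inner (β.continuous.comp_continuousOn hc))
  -- Testing against the eigenvector ψ_k turns the weak equation into a scalar one, to which
  -- variation of constants applies.
  have key := exp_mul_eq_of_integral_eq (l := ev k) hyc hfi (fun r hr => by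
    rw [Set.uIcc_of_le ht] at hr
    have h := hφ.2 r hr.1 ⟨ψ k, hdom k⟩
    rw [hφ.apply_zero hdom]
    simpa only [heig, inner_smul_left, Complex.conj_ofReal] using h)
  rw [inner_flow, mul_comm t, key, hφ.apply_zero hdom, inner_add_right]
  congr 1
  have h3 := (innerSL ℂ (ψ k)).intervalIntegral_comp_comm hi
  simp only [innerSL_apply_apply] at h3
  rw [← h3]
  congr 1
  ext s
  rw [inner_smul_right, coupling_apply, flow_neg_flow, inner_flow, mul_comm (ev k)]
  ring

variable (ψ ev)

/-- The state after `n` passages through a defect with propagator `U`. -/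
def stateAt (U : H →L[ℂ] H) (T : ℝ) (d : ℕ → ℝ) (x : H) : ℕ → H
  | 0 => x
  | n + 1 => flow ψ ev (-T) (U (flow ψ ev (-d n) (stateAt U T d x n)))

theorem norm_stateAt {U : H →L[ℂ] H} (hU : ∀ x, ‖U x‖ = ‖x‖) (T : ℝ) (d : ℕ → ℝ) (x : H)
    (n : ℕ) : ‖stateAt ψ ev U T d x n‖ = ‖x‖ := by
  induction n with
  | zero => rfl
  | succ n ih => rw [stateAt, LinearIsometryEquiv.norm_map, hU, LinearIsometryEquiv.norm_map, ih]

variable {ψ ev}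

/-- On the i-th cycle only one defect acts. Moving the time origin to its onset o and conjugating by
the free flow over o gives the single-defect equation on [-d_i, T], whose solutions are unique. -/
theorem IsSolution.eq_propagator {T : ℝ} {g₀ : ℝ → ℝ} {d : ℕ → ℝ} {φ₀ : H} {φ : ℝ → H}
    (hφ : IsSolution H₀ β ε (train T g₀ d) φ₀ φ) (hdom : ∀ j, ψ j ∈ H₀.domain)
    (heig : ∀ j, H₀ ⟨ψ j, hdom j⟩ = (ev j : ℂ) • ψ j)
    (hD : IsDefect (coupling ψ ev β) g₀ T) {S : ℝ → H →L[ℂ] H}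
    (hS : IsPropagator (coupling ψ ev β) g₀ ε S) (hd : ∀ i, 0 ≤ d i) (i : ℕ) {t : ℝ}
    (ht : t ∈ Set.Icc (defectEnd T d i) (defectEnd T d (i + 1))) :
    φ t = flow ψ ev (-(t - onset T d i)) (S (t - onset T d i)
      (flow ψ ev (-d i) (φ (defectEnd T d i)))) := by
  set a := defectEnd T d i with ha
  set o := onset T d i with ho
  have hoa : o = a + d i := onset_eq i
  have he : defectEnd T d (i + 1) = o + T := defectEnd_succ i
  have ha0 : 0 ≤ a := by
    have := mul_le_defectEnd (T := T) hd i
    have h2 : 0 ≤ (i : ℝ) * T := mul_nonneg (Nat.cast_nonneg _) hD.pos.le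
    linarith
  have hg : ∀ t, 0 ≤ t → IntervalIntegrable (train T g₀ d) volume 0 t :=
    intervalIntegrable_train hD.int hD.supp hD.pos hd
  set u : ℝ → H := fun s => flow ψ ev s (φ s) with hu
  have huc : ∀ {r}, a ≤ r → ContinuousOn u (Set.uIcc a r) := fun {r} hr => by
    refine (continuous_flow ψ ev).comp_continuousOn (continuousOn_id.prodMk (hφ.1.mono ?_))
    rw [Set.uIcc_of_le hr]
    exact (Set.Icc_subset_Ici_self).trans (Set.Ici_subset_Ici.2 ha0)
  have hueq : ∀ r ∈ Set.Icc a (o + T), u r = u a + ∫ s in a..r,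
      (-Complex.I * ε * (g₀ (s - o) : ℂ)) • coupling ψ ev β s (u s) := by
    intro r hr
    have hi : ∀ {p}, 0 ≤ p → IntervalIntegrable
        (fun s => (-Complex.I * ε * (train T g₀ d s : ℂ)) • coupling ψ ev β s (u s))
        volume 0 p := fun {p} hp => by
      refine intervalIntegrable_smul_apply (continuous_coupling ψ ev β) (hg p hp) _ ?_
      refine (continuous_flow ψ ev).comp_continuousOn (continuousOn_id.prodMk (hφ.1.mono ?_))
      rw [Set.uIcc_of_le hp]
      exact Set.Icc_subset_Ici_self
    have h1 := hφ.interaction hdom heig hg (ha0.trans hr.1)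
    have h2 := hφ.interaction hdom heig hg ha0
    have h3 := intervalIntegral.integral_interval_sub_left (hi (ha0.trans hr.1)) (hi ha0)
    have h4 : ∫ s in a..r, (-Complex.I * ε * (train T g₀ d s : ℂ)) • coupling ψ ev β s (u s) =
        ∫ s in a..r, (-Complex.I * ε * (g₀ (s - o) : ℂ)) • coupling ψ ev β s (u s) := by
      refine intervalIntegral.integral_congr_ae ?_
      filter_upwards [ae_train_eq hD.supp hD.pos hd i] with s hs hsm
      rw [Set.uIoc_of_le hr.1] at hsm
      rw [hs ⟨hsm.1.le, hsm.2.trans (by rw [he]; exact hr.2)⟩]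
    change flow ψ ev r (φ r) = flow ψ ev a (φ a) + _
    rw [h1, h2, ← h4, ← h3]
    abel
  set v : ℝ → H := fun r => flow ψ ev (-o) (u (r + o)) with hv
  have hv2 : ∀ r, v r = flow ψ ev r (φ (r + o)) := fun r => by
    simp only [hv, hu, flow_flow]; congr 2; ring
  have hvc : ContinuousOn v (Set.Icc (-d i) T) := by
    refine (flow ψ ev (-o)).continuous.comp_continuousOn ?_
    refine (huc (r := o + T) (by linarith [hd i, hD.pos])).comp
      (continuous_id.add continuous_const).continuousOn fun r hr => ?_
    rw [Set.uIcc_of_le (by linarith [hd i, hD.pos])]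
    exact ⟨by change a ≤ r + o; linarith [hr.1], by change r + o ≤ o + T; linarith [hr.2]⟩
  have hveq : ∀ r ∈ Set.Icc (-d i) T, v r = v (-d i) + ∫ s in (-d i)..r,
      (-Complex.I * ε * (g₀ s : ℂ)) • coupling ψ ev β s (v s) := by
    intro r hr
    have h1 := hueq (r + o) ⟨by linarith [hr.1], by linarith [hr.2]⟩
    have hii : IntervalIntegrable
        (fun s => (-Complex.I * ε * (g₀ (s - o) : ℂ)) • coupling ψ ev β s (u s))
        volume a (r + o) :=
      intervalIntegrable_smul_apply (continuous_coupling ψ ev β)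
        ((hD.int.comp_sub_right o).intervalIntegrable) _ (huc (by linarith [hr.1]))
    have h2 := ((flow ψ ev (-o)).toContinuousLinearEquiv :
      H →L[ℂ] H).intervalIntegral_comp_comm hii
    have h3 : v r = flow ψ ev (-o) (u a) + ((flow ψ ev (-o)).toContinuousLinearEquiv :
      H →L[ℂ] H) (∫ s in a..(r + o),
        (-Complex.I * ε * (g₀ (s - o) : ℂ)) • coupling ψ ev β s (u s)) := by
      change flow ψ ev (-o) (u (r + o)) = _
      rw [h1, map_add]
      rfl
    have h4 : flow ψ ev (-o) (u a) = v (-d i) := by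
      change _ = flow ψ ev (-o) (u (-d i + o))
      rw [hoa]; congr 2; ring
    rw [h3, ← h2, h4]
    congr 1
    have h5 := intervalIntegral.integral_comp_add_right (a := -d i) (b := r)
      (fun s => ((flow ψ ev (-o)).toContinuousLinearEquiv : H →L[ℂ] H)
        ((-Complex.I * ε * (g₀ (s - o) : ℂ)) • coupling ψ ev β s (u s))) o
    rw [show -d i + o = a by rw [hoa]; ring] at h5
    rw [← h5]
    congr 1
    ext s
    rw [map_smul, add_sub_cancel_right]
    congr 1
    -- Conjugation by the flow shifts the time argument of the coupling, which makes the equation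
    -- the same for every defect.
    change flow ψ ev (-o) (coupling ψ ev β (s + o) (u (s + o))) =
      coupling ψ ev β s (flow ψ ev (-o) (u (s + o)))
    rw [coupling_apply, coupling_apply, flow_flow, flow_flow ψ ev (-s),
      show -o + (s + o) = s by ring, show -s + -o = -(s + o) by ring]
  have hr : t - o ∈ Set.Icc (-d i) T := ⟨by linarith [ht.1], by
    have := ht.2
    rw [he] at this
    linarith⟩
  have hfin := hS.eq_of_solution hD (by linarith [hd i]) hvc hveq hr
  rw [hv2, hv2, sub_add_cancel, show -d i + o = a by rw [hoa]; ring] at hfin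
  rw [← hfin, flow_neg_flow]

theorem IsSolution.eq_stateAt {T : ℝ} {g₀ : ℝ → ℝ} {d : ℕ → ℝ} {φ₀ : H} {φ : ℝ → H}
    (hφ : IsSolution H₀ β ε (train T g₀ d) φ₀ φ) (hdom : ∀ j, ψ j ∈ H₀.domain)
    (heig : ∀ j, H₀ ⟨ψ j, hdom j⟩ = (ev j : ℂ) • ψ j)
    (hD : IsDefect (coupling ψ ev β) g₀ T) {S : ℝ → H →L[ℂ] H}
    (hS : IsPropagator (coupling ψ ev β) g₀ ε S) (hd : ∀ i, 0 ≤ d i) (n : ℕ) :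
    φ (defectEnd T d n) = stateAt ψ ev (S T) T d φ₀ n := by
  induction n with
  | zero => rw [defectEnd_zero, hφ.apply_zero hdom, stateAt]
  | succ n ih =>
    have h := hφ.eq_propagator hdom heig hD hS hd n
      (Set.right_mem_Icc.2 (defectEnd_mono hD.pos hd n.le_succ))
    rw [h, ih, defectEnd_succ, add_sub_cancel_left, stateAt]

end Pathwise

/-! ### Averaging over one random phase. -/

section RandomPhase

variable {H : Type*} [NormedAddCommGroup H] [InnerProductSpace ℂ H] {ι : Type*}
  (ψ : HilbertBasis ι ℂ H)

theorem summable_norm_inner_mul (b x : H) :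
    Summable fun j => ‖inner ℂ b (ψ j) * inner ℂ (ψ j) x‖ := by
  have h : ∀ z : H, Summable fun j => ‖inner ℂ (ψ j) z‖ ^ 2 := fun z => (hasSum_norm_sq ψ z).summable
  refine Summable.of_nonneg_of_le (fun _ => norm_nonneg _) (fun j => ?_) ((h b).add (h x))
  rw [norm_mul, norm_inner_symm b]
  nlinarith [sq_nonneg (‖inner ℂ (ψ j) b‖ - ‖inner ℂ (ψ j) x‖), sq_nonneg ‖inner ℂ (ψ j) b‖,
    sq_nonneg ‖inner ℂ (ψ j) x‖]

/-- Averaging a summable trigonometric series with pairwise orthogonal frequencies. -/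
theorem integral_norm_sq_tsum_exp [Countable ι] {ν : Measure ℝ} [IsProbabilityMeasure ν]
    {ev : ι → ℝ}
    (hν : ∀ j k, j ≠ k → ∫ D, Complex.exp (Complex.I * ((ev j - ev k : ℝ) : ℂ) * (D : ℂ)) ∂ν = 0)
    {c : ι → ℂ} (hc : Summable fun j => ‖c j‖) :
    ∫ D, ‖∑' j, Complex.exp (Complex.I * ((-D * ev j : ℝ) : ℂ)) * c j‖ ^ 2 ∂ν =
      ∑' j, ‖c j‖ ^ 2 := by
  classical
  set e : ι → ℝ → ℂ := fun j D => Complex.exp (Complex.I * ((-D * ev j : ℝ) : ℂ)) with he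
  have hec : ∀ j, Continuous (e j) := fun j => by simp only [he]; fun_prop
  have hen : ∀ j D, ‖e j D‖ = 1 := fun j D => norm_exp_I_mul _
  have hterm : ∀ j D, ‖e j D * c j‖ = ‖c j‖ := fun j D => by rw [norm_mul, hen, one_mul]
  set z : ℝ → ℂ := fun D => ∑' j, e j D * c j with hz
  have hzc : Continuous z := continuous_tsum (fun j => (hec j).mul continuous_const) hc
    (fun j D => (hterm j D).le)
  have hzb : ∀ D, ‖z D‖ ≤ ∑' j, ‖c j‖ := fun D =>
    (norm_tsum_le_tsum_norm (by simpa only [hterm] using hc)).trans_eq (by simp only [hterm])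
  have hbd : ∀ {f : ℝ → ℂ} {C : ℝ}, Continuous f → (∀ D, ‖f D‖ ≤ C) → Integrable f ν :=
    fun {f C} hf hb => Integrable.of_bound hf.aestronglyMeasurable C (Filter.Eventually.of_forall hb)
  have horth : ∀ j k, ∫ D, (starRingEnd ℂ) (e j D) * e k D ∂ν = if k = j then 1 else 0 := by
    intro j k
    have h1 : ∀ D, (starRingEnd ℂ) (e j D) * e k D =
        Complex.exp (Complex.I * ((ev j - ev k : ℝ) : ℂ) * (D : ℂ)) := fun D => by
      simp only [he]
      rw [conj_exp_I_mul, exp_I_mul_mul_exp, mul_assoc, ← Complex.ofReal_mul]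
      congr 3; ring
    simp only [h1]
    split_ifs with h
    · subst h; simp
    · exact hν j k (Ne.symm h)
  -- Orthonormality of the exponentials under ν recovers each coefficient of the series. Expanding
  -- only the conjugate factor of |z|² then yields Parseval's identity.
  have hcoef : ∀ j, ∫ D, (starRingEnd ℂ) (e j D) * z D ∂ν = c j := by
    intro j
    have h1 : ∀ k D, ‖(starRingEnd ℂ) (e j D) * (e k D * c k)‖ = ‖c k‖ := fun k D => by
      rw [norm_mul, hterm, RCLike.norm_conj, hen, one_mul]
    have h2 := hasSum_integral_of_summable_integral_norm (μ := ν)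
      (F := fun k D => (starRingEnd ℂ) (e j D) * (e k D * c k))
      (fun k => hbd ((Complex.continuous_conj.comp (hec j)).mul ((hec k).mul continuous_const))
        (fun D => (h1 k D).le))
      (by simpa only [h1, integral_const, probReal_univ, one_smul] using hc)
    have h3 : ∀ D, ∑' k, (starRingEnd ℂ) (e j D) * (e k D * c k) =
        (starRingEnd ℂ) (e j D) * z D := fun D => tsum_mul_left
    have h4 : ∀ k, ∫ D, (starRingEnd ℂ) (e j D) * (e k D * c k) ∂ν =
        if k = j then c j else 0 := fun k => by
      simp only [← mul_assoc]
      rw [integral_mul_const, horth]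
      split_ifs with h
      · rw [h, one_mul]
      · rw [zero_mul]
    simp only [h3, h4] at h2
    rw [← h2.tsum_eq]
    exact tsum_ite_eq j fun _ => c j
  have hz2 : ∀ D, ((‖z D‖ ^ 2 : ℝ) : ℂ) = ∑' j, (starRingEnd ℂ) (c j) *
      ((starRingEnd ℂ) (e j D) * z D) := fun D => by
    have h1 : (starRingEnd ℂ) (z D) = ∑' j, (starRingEnd ℂ) (e j D * c j) := by
      simp only [hz]
      exact Complex.conj_tsum _
    rw [Complex.ofReal_pow, ← Complex.conj_mul', h1, ← tsum_mul_right]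
    congr 1; ext j
    rw [map_mul]; ring
  have hint := hasSum_integral_of_summable_integral_norm (μ := ν)
      (F := fun j D => (starRingEnd ℂ) (c j) * ((starRingEnd ℂ) (e j D) * z D))
      (fun j => hbd (C := ‖c j‖ * (∑' j, ‖c j‖))
        (continuous_const.mul ((Complex.continuous_conj.comp (hec j)).mul hzc)) (fun D => by
          rw [norm_mul, norm_mul, RCLike.norm_conj, RCLike.norm_conj, hen, one_mul]
          exact mul_le_mul_of_nonneg_left (hzb D) (norm_nonneg _)))
      (by
        refine Summable.of_nonneg_of_le (fun j => integral_nonneg fun _ => norm_nonneg _)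
          (fun j => ?_) (hc.mul_right (∑' j, ‖c j‖))
        refine (integral_mono_of_nonneg (Filter.Eventually.of_forall fun _ => norm_nonneg _)
          (integrable_const (‖c j‖ * (∑' j, ‖c j‖))) (Filter.Eventually.of_forall fun D => ?_)).trans
          (by simp)
        simp only [norm_mul, RCLike.norm_conj, hen, one_mul]
        exact mul_le_mul_of_nonneg_left (hzb D) (norm_nonneg _))
  simp only [← hz2, integral_const_mul, hcoef] at hint
  rw [integral_complex_ofReal] at hint
  have h5 := Complex.hasSum_re hint
  simp only [Complex.ofReal_re] at h5
  rw [← h5.tsum_eq]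
  congr 1; ext j
  rw [Complex.conj_mul', ← Complex.ofReal_pow, Complex.ofReal_re]

variable [CompleteSpace H]

theorem integral_norm_sq_inner_flow [Countable ι] {ν : Measure ℝ} [IsProbabilityMeasure ν]
    {ev : ι → ℝ}
    (hν : ∀ j k, j ≠ k → ∫ D, Complex.exp (Complex.I * ((ev j - ev k : ℝ) : ℂ) * (D : ℂ)) ∂ν = 0)
    (b x : H) : ∫ D, ‖inner ℂ b (flow ψ ev (-D) x)‖ ^ 2 ∂ν =
      ∑' j, ‖inner ℂ b (ψ j)‖ ^ 2 * ‖inner ℂ (ψ j) x‖ ^ 2 := by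
  have h := integral_norm_sq_tsum_exp hν (summable_norm_inner_mul ψ b x)
  simp only [norm_mul, mul_pow] at h
  rw [← h]
  congr 1; ext D
  rw [← (ψ.hasSum_inner_mul_inner b (flow ψ ev (-D) x)).tsum_eq]
  congr 3; ext j
  rw [inner_flow]; ring

end RandomPhase

/-! ### Integrating out a waiting time that is independent of the past. -/

section Independence

/-- Needed so that continuous functions on products involving `H` are measurable for the product
σ-algebra. -/
theorem secondCountable_of_hilbertBasis {H : Type*} [NormedAddCommGroup H] [InnerProductSpace ℂ H]
    {ι : Type*} [Countable ι] (ψ : HilbertBasis ι ℂ H) : SecondCountableTopology H := by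
  have h1 : TopologicalSpace.IsSeparable (Submodule.span ℂ (Set.range ψ) : Set H) :=
    (Set.countable_range ψ).isSeparable.span
  have h2 : Dense (Submodule.span ℂ (Set.range ψ) : Set H) := by
    rw [Submodule.dense_iff_topologicalClosure_eq_top]
    exact ψ.dense_span
  have : TopologicalSpace.SeparableSpace H := by
    rw [← TopologicalSpace.isSeparable_univ_iff, ← h2.closure_eq]
    exact h1.closure
  exact UniformSpace.secondCountable_of_separable H

variable {Ω : Type*} [MeasurableSpace Ω] {μ : Measure Ω} [IsProbabilityMeasure μ]

theorem indepFun_prod_left {α β γ : Type*} [MeasurableSpace α] [MeasurableSpace β]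
    [MeasurableSpace γ] {X : Ω → α} {Y : Ω → β} {Z : Ω → γ} (hX : Measurable X)
    (hY : Measurable Y) (hZ : Measurable Z) (h1 : IndepFun X (fun ω => (Y ω, Z ω)) μ)
    (h2 : IndepFun Y Z μ) : IndepFun (fun ω => (X ω, Y ω)) Z μ := by
  have : IsProbabilityMeasure (μ.map X) := Measure.isProbabilityMeasure_map hX.aemeasurable
  have : IsProbabilityMeasure (μ.map Y) := Measure.isProbabilityMeasure_map hY.aemeasurable
  have : IsProbabilityMeasure (μ.map Z) := Measure.isProbabilityMeasure_map hZ.aemeasurable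
  have hXY : IndepFun X Y μ := h1.comp measurable_id measurable_fst
  rw [indepFun_iff_map_prod_eq_prod_map_map (hX.prodMk hY).aemeasurable hZ.aemeasurable,
    hXY.map_prod_eq_prod_map_map hX.aemeasurable hY.aemeasurable,
    ← MeasurableEquiv.prodAssoc.map_measurableEquiv_injective.eq_iff, Measure.prodAssoc_prod,
    ← h2.map_prod_eq_prod_map_map hY.aemeasurable hZ.aemeasurable,
    ← h1.map_prod_eq_prod_map_map hX.aemeasurable (hY.prodMk hZ).aemeasurable,
    Measure.map_map MeasurableEquiv.prodAssoc.measurable ((hX.prodMk hY).prodMk hZ)]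
  rfl

theorem IndepFun.integral_comp_prod {α β : Type*} [MeasurableSpace α] [MeasurableSpace β]
    {X : Ω → α} {Y : Ω → β} (h : IndepFun X Y μ) (hX : Measurable X) (hY : Measurable Y)
    {f : α × β → ℝ} (hf : StronglyMeasurable f) (hi : Integrable (fun ω => f (X ω, Y ω)) μ) :
    ∫ ω, f (X ω, Y ω) ∂μ = ∫ ω, (∫ y, f (X ω, y) ∂(μ.map Y)) ∂μ := by
  have : IsProbabilityMeasure (μ.map X) := Measure.isProbabilityMeasure_map hX.aemeasurable
  have : IsProbabilityMeasure (μ.map Y) := Measure.isProbabilityMeasure_map hY.aemeasurable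
  have hm := h.map_prod_eq_prod_map_map hX.aemeasurable hY.aemeasurable
  have hi' : Integrable f ((μ.map X).prod (μ.map Y)) := by
    rw [← hm, integrable_map_measure hf.aestronglyMeasurable (hX.prodMk hY).aemeasurable]
    exact hi
  rw [← integral_map (φ := fun ω => (X ω, Y ω)) (hX.prodMk hY).aemeasurable
    hf.aestronglyMeasurable, hm, integral_prod _ hi',
    integral_map hX.aemeasurable hf.integral_prod_right'.aestronglyMeasurable]

variable {H : Type*} [NormedAddCommGroup H] [InnerProductSpace ℂ H] [CompleteSpace H]
  [MeasurableSpace H] [BorelSpace H] {ι : Type*} [Countable ι] (ψ : HilbertBasis ι ℂ H)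

/-- Evolution of weighted expected powers under a random phase followed by a unitary. -/
theorem integral_weight_norm_sq {ev : ι → ℝ} {D : Ω → ℝ} (hD : Measurable D)
    (hphase : ∀ j k, j ≠ k →
      ∫ ω, Complex.exp (Complex.I * ((ev j - ev k : ℝ) : ℂ) * (D ω : ℂ)) ∂μ = 0)
    {X : Ω → H} (hX : Measurable X) (hX2 : Integrable (fun ω => ‖X ω‖ ^ 2) μ) {c : Ω → ℝ}
    (hc : Measurable c) (hc1 : ∀ ω, |c ω| ≤ 1) (hind : IndepFun (fun ω => (c ω, X ω)) D μ)
    {U : H →L[ℂ] H} (hU : ∀ x, ‖U x‖ = ‖x‖) (k : ι) :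
    ∫ ω, c ω * ‖inner ℂ (ψ k) (U (flow ψ ev (-D ω) (X ω)))‖ ^ 2 ∂μ =
      ∑' j, ‖inner ℂ (ψ k) (U (ψ j))‖ ^ 2 * ∫ ω, c ω * ‖inner ℂ (ψ j) (X ω)‖ ^ 2 ∂μ := by
  have := secondCountable_of_hilbertBasis ψ
  -- Moving `U` onto ψ_k leaves an inner product of a fixed vector with a randomly phased one.
  set b := ContinuousLinearMap.adjoint U (ψ k) with hb
  have hbU : ∀ y, inner ℂ (ψ k) (U y) = inner ℂ b y := fun y =>
    (ContinuousLinearMap.adjoint_inner_left U y (ψ k)).symm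
  have hbn : ∀ y, ‖inner ℂ b y‖ ≤ ‖y‖ := fun y => by
    rw [← hbU]
    refine (norm_inner_le_norm _ _).trans_eq ?_
    rw [ψ.orthonormal.1 k, one_mul, hU]
  have : IsProbabilityMeasure (μ.map D) := Measure.isProbabilityMeasure_map hD.aemeasurable
  have hν : ∀ j k, j ≠ k →
      ∫ d, Complex.exp (Complex.I * ((ev j - ev k : ℝ) : ℂ) * (d : ℂ)) ∂(μ.map D) = 0 := by
    intro j k hjk
    rw [integral_map hD.aemeasurable (by fun_prop)]
    exact hphase j k hjk
  have hbound : ∀ {f : Ω → ℝ}, Measurable f → (∀ ω, |f ω| ≤ ‖X ω‖ ^ 2) → Integrable f μ :=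
    fun {f} hf h => hX2.mono' hf.aestronglyMeasurable (Filter.Eventually.of_forall h)
  have hle : ∀ (r : ℂ) (ω : Ω), ‖r‖ ≤ ‖X ω‖ → |c ω * ‖r‖ ^ 2| ≤ ‖X ω‖ ^ 2 := fun r ω hr => by
    rw [abs_mul, abs_of_nonneg (sq_nonneg ‖r‖)]
    exact (mul_le_of_le_one_left (sq_nonneg _) (hc1 ω)).trans
      (pow_le_pow_left₀ (norm_nonneg _) hr 2)
  have hcoord : ∀ j, Measurable fun ω => c ω * ‖inner ℂ (ψ j) (X ω)‖ ^ 2 := fun j => by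
    have h : Continuous fun x : H => ‖inner ℂ (ψ j) x‖ ^ 2 := by fun_prop
    exact hc.mul (h.measurable.comp hX)
  have hcoordi : ∀ j, Integrable (fun ω => c ω * ‖inner ℂ (ψ j) (X ω)‖ ^ 2) μ := fun j =>
    hbound (hcoord j) fun ω => hle _ ω <| (norm_inner_le_norm _ _).trans_eq (by
      rw [ψ.orthonormal.1 j, one_mul])
  set f : (ℝ × H) × ℝ → ℝ := fun p => p.1.1 * ‖inner ℂ b (flow ψ ev (-p.2) p.1.2)‖ ^ 2 with hf
  have hfc : Continuous f := by
    have h1 : Continuous fun p : (ℝ × H) × ℝ => flow ψ ev (-p.2) p.1.2 :=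
      (continuous_flow ψ ev).comp (continuous_snd.neg.prodMk (continuous_snd.comp continuous_fst))
    exact (continuous_fst.comp continuous_fst).mul ((continuous_const.inner h1).norm.pow 2)
  have hfi : Integrable (fun ω => f ((c ω, X ω), D ω)) μ :=
    hbound (hfc.measurable.comp ((hc.prodMk hX).prodMk hD)) fun ω =>
      hle _ ω ((hbn _).trans_eq ((flow ψ ev _).norm_map _))
  have h1 := IndepFun.integral_comp_prod hind (hc.prodMk hX) hD hfc.stronglyMeasurable hfi
  simp only [hf, integral_const_mul, integral_norm_sq_inner_flow ψ hν b] at h1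
  simp only [hbU]
  rw [h1]
  have hsplit : ∀ ω, c ω * ∑' j, ‖inner ℂ b (ψ j)‖ ^ 2 * ‖inner ℂ (ψ j) (X ω)‖ ^ 2 =
      ∑' j, ‖inner ℂ b (ψ j)‖ ^ 2 * (c ω * ‖inner ℂ (ψ j) (X ω)‖ ^ 2) := fun ω => by
    rw [← tsum_mul_left]
    congr 1; ext j; ring
  have hb1 : ∀ j, ‖inner ℂ b (ψ j)‖ ^ 2 ≤ 1 := fun j => by
    have := hbn (ψ j)
    rw [ψ.orthonormal.1 j] at this
    exact pow_le_one₀ (norm_nonneg _) this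
  have hsum : L1Le (fun j => ∫ ω, |c ω * ‖inner ℂ (ψ j) (X ω)‖ ^ 2| ∂μ) (∫ ω, ‖X ω‖ ^ 2 ∂μ) := by
    refine L1Le.integral (fun j => (hcoordi j).abs) hX2 (Filter.Eventually.of_forall fun ω s => ?_)
    refine (Finset.sum_le_sum fun j _ => ?_).trans (l1Le_norm_sq ψ (X ω) s)
    rw [abs_abs, abs_mul]
    exact mul_le_of_le_one_left (abs_nonneg _) (hc1 ω)
  have h2 := hasSum_integral_of_summable_integral_norm (μ := μ)
    (F := fun j ω => ‖inner ℂ b (ψ j)‖ ^ 2 * (c ω * ‖inner ℂ (ψ j) (X ω)‖ ^ 2))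
    (fun j => (hcoordi j).const_mul _) (by
      refine Summable.of_nonneg_of_le (fun j => integral_nonneg fun _ => norm_nonneg _)
        (fun j => ?_) hsum.summable
      simp only [norm_mul, Real.norm_eq_abs, abs_mul, integral_const_mul, abs_pow, abs_norm]
      rw [abs_of_nonneg (integral_nonneg fun ω => by positivity)]
      exact mul_le_of_le_one_left (integral_nonneg fun ω => by positivity) (hb1 j))
  simp only [hsplit]
  rw [← h2.tsum_eq]
  simp only [integral_const_mul]

end Independence

/-! ### Matrix columns with a prescribed sum. -/

section Columns

variable {ι : Type*}

open Classical in
theorem l1Le_single (j : ι) (r : ℝ) : L1Le (fun k => if k = j then r else 0) |r| := fun s => by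
  rw [Finset.sum_congr rfl (g := fun k => if k = j then |r| else 0)
    (fun k _ => by by_cases h : k = j <;> simp [h]), Finset.sum_ite_eq']
  split_ifs
  · exact le_rfl
  · exact abs_nonneg _

theorem L1Le.abs_tsum_le {p : ι → ℝ} {a : ℝ} (h : L1Le p a) : |∑' k, p k| ≤ a := by
  have := norm_tsum_le_tsum_norm (f := p) (by simpa using h.summable)
  exact this.trans h.tsum_le

open Classical in
/-- Replacing the diagonal entry of a column so that the column sums to zero at most doubles the
`ℓ¹` norm. -/
theorem L1Le.sub_single_tsum {p : ι → ℝ} {a : ℝ} (h : L1Le p a) (j : ι) :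
    L1Le (fun k => p k - if k = j then ∑' l, p l else 0) (2 * a) :=
  (h.sub (l1Le_single j _)).mono (by linarith [h.abs_tsum_le])

open Classical in
theorem tsum_off_diag {p : ι → ℝ} {c : ℝ} (h : HasSum p c) (j : ι) :
    HasSum (fun k => if k = j then 0 else p k) (c - p j) := by
  have h1 := h.sub (hasSum_ite_eq j (p j))
  refine h1.congr_fun ?_
  intro k
  by_cases hk : k = j <;> simp [hk]

theorem L1Le.of_abs_le {p q : ι → ℝ} {a : ℝ} (hq : L1Le q a) (h : ∀ k, |p k| ≤ |q k|) :
    L1Le p a := fun s => (Finset.sum_le_sum fun k _ => h k).trans (hq s)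

theorem L1Le.congr {p q : ι → ℝ} {a : ℝ} (hq : L1Le q a) (h : ∀ k, p k = q k) : L1Le p a :=
  hq.of_abs_le fun k => by rw [h k]

end Columns

/-! ### Comparison of the exact transition matrix with the transfer operator. -/

section Transfer

variable {H : Type*} [NormedAddCommGroup H] [InnerProductSpace ℂ H] {ι : Type*}
  {ψ : HilbertBasis ι ℂ H} {ev : ι → ℝ} {β : H →L[ℂ] H} {g₀ : ℝ → ℝ} {T ε : ℝ}

theorem norm_fourierHat_neg (g : ℝ → ℝ) (ξ : ℝ) : ‖fourierHat g (-ξ)‖ = ‖fourierHat g ξ‖ := by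
  have h : fourierHat g (-ξ) = (starRingEnd ℂ) (fourierHat g ξ) := by
    simp only [fourierHat]
    rw [← integral_conj]
    congr 1; ext t
    rw [map_mul, ← Complex.exp_conj]
    simp
  rw [h, RCLike.norm_conj]

theorem rate_nonneg (k j : ι) : 0 ≤ rate ψ ev β g₀ k j := by
  unfold rate; positivity

/-- Transition probabilities of a unitary between basis states. -/
def trans (ψ : HilbertBasis ι ℂ H) (U : H →L[ℂ] H) (k j : ι) : ℝ := ‖inner ℂ (ψ k) (U (ψ j))‖ ^ 2

theorem hasSum_trans {U : H →L[ℂ] H} (hU : ∀ x, ‖U x‖ = ‖x‖) (j : ι) :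
    HasSum (fun k => trans ψ U k j) 1 := by
  have h := hasSum_norm_sq ψ (U (ψ j))
  rwa [hU, ψ.orthonormal.1 j, one_pow] at h

theorem l1Le_trans {U : H →L[ℂ] H} (hU : ∀ x, ‖U x‖ = ‖x‖) (j : ι) :
    L1Le (fun k => trans ψ U k j) 1 := by
  have h := l1Le_norm_sq ψ (U (ψ j))
  rwa [hU, ψ.orthonormal.1 j, one_pow] at h

theorem inner_sub_basis (x : H) {k j : ι} (h : k ≠ j) :
    inner ℂ (ψ k) (x - ψ j) = inner ℂ (ψ k) x := by
  rw [inner_sub_right, ψ.orthonormal.2 h, sub_zero]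

variable [CompleteSpace H]

theorem rate_symm (hβ : IsSelfAdjoint β) (k j : ι) :
    rate ψ ev β g₀ k j = rate ψ ev β g₀ j k := by
  have h1 : ‖inner ℂ (ψ k) (β (ψ j))‖ = ‖inner ℂ (ψ j) (β (ψ k))‖ := by
    rw [norm_inner_symm]
    exact congrArg norm ((ContinuousLinearMap.isSelfAdjoint_iff_isSymmetric.1 hβ) (ψ j) (ψ k))
  rw [rate, rate, h1, ← norm_fourierHat_neg, neg_neg, neg_sub]

/-- The first order coefficient of the propagator. -/
def firstOrder (ψ : HilbertBasis ι ℂ H) (ev : ι → ℝ) (β : H →L[ℂ] H) (g₀ : ℝ → ℝ) (T : ℝ)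
    (x : H) : H :=
  ∫ s in (0 : ℝ)..T, (1 * (g₀ s : ℂ)) • coupling ψ ev β s x

/-- In the interaction picture the matrix element oscillates as e^{isΔ_kj} α_kj, so integrating
against `g₀` produces its Fourier transform at -Δ_kj. This is where the rates in B come from. -/
theorem norm_sq_inner_firstOrder (hD : IsDefect (coupling ψ ev β) g₀ T) (k j : ι) :
    ‖inner ℂ (ψ k) (firstOrder ψ ev β g₀ T (ψ j))‖ ^ 2 = rate ψ ev β g₀ k j := by
  have hi : IntervalIntegrable (fun s => (1 * (g₀ s : ℂ)) • coupling ψ ev β s (ψ j)) volume 0 T :=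
    hD.integrand 1 continuousOn_const
  have h1 := (innerSL ℂ (ψ k)).intervalIntegral_comp_comm hi
  simp only [innerSL_apply_apply] at h1
  have h2 : inner ℂ (ψ k) (firstOrder ψ ev β g₀ T (ψ j)) =
      fourierHat g₀ (-(ev k - ev j)) * inner ℂ (ψ k) (β (ψ j)) := by
    rw [firstOrder, ← h1, intervalIntegral.integral_of_le hD.pos.le,
      ← integral_Icc_eq_integral_Ioc, setIntegral_eq_integral_of_forall_compl_eq_zero,
      fourierHat, ← integral_mul_const]
    · congr 1; ext s
      rw [inner_smul_right, inner_coupling_basis]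
      have : -(Complex.I * ((-(ev k - ev j) : ℝ) : ℂ) * (s : ℂ)) =
          Complex.I * ((s * (ev k - ev j) : ℝ) : ℂ) := by push_cast; ring
      rw [this]; ring
    · intro s hs
      have : g₀ s = 0 := by
        by_contra h
        exact hs (hD.supp h)
      simp [this]
  rw [h2, norm_mul, mul_pow, rate, mul_comm]

theorem summable_rate (hD : IsDefect (coupling ψ ev β) g₀ T) (j : ι) :
    Summable fun k => rate ψ ev β g₀ k j := by
  simp only [← norm_sq_inner_firstOrder hD]
  exact (hasSum_norm_sq ψ _).summable

open Classical in
/-- The matrix of the transfer operator. -/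
def transferMat (ψ : HilbertBasis ι ℂ H) (ev : ι → ℝ) (β : H →L[ℂ] H) (g₀ : ℝ → ℝ) (ε : ℝ)
    (k j : ι) : ℝ := (if k = j then 1 else 0) - ε ^ 2 * matB ψ ev β g₀ k j

/-- Total transition rate out of a state. -/
def totalRate (ψ : HilbertBasis ι ℂ H) (ev : ι → ℝ) (β : H →L[ℂ] H) (g₀ : ℝ → ℝ) (j : ι) : ℝ :=
  ∑' k, rate ψ ev β g₀ k j - rate ψ ev β g₀ j j

theorem totalRate_nonneg (hD : IsDefect (coupling ψ ev β) g₀ T) (j : ι) :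
    0 ≤ totalRate ψ ev β g₀ j :=
  sub_nonneg.2 ((summable_rate hD j).le_tsum j fun k _ => rate_nonneg k j)

theorem totalRate_le (hD : IsDefect (coupling ψ ev β) g₀ T) (j : ι) :
    totalRate ψ ev β g₀ j ≤ 1 := by
  have h1 : ∑' k, rate ψ ev β g₀ k j ≤ 1 := by
    simp only [← norm_sq_inner_firstOrder hD]
    rw [(hasSum_norm_sq ψ _).tsum_eq]
    have h := hD.norm_integral_le (ψ j)
    rw [ψ.orthonormal.1 j] at h
    exact pow_le_one₀ (norm_nonneg _) h
  have := rate_nonneg (ψ := ψ) (ev := ev) (β := β) (g₀ := g₀) j j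
  unfold totalRate
  linarith

open Classical in
-- Symmetry of the rates turns the row sum on the diagonal into a column sum. Column sums are what
-- ℓ¹ estimates use.
theorem matB_eq (hD : IsDefect (coupling ψ ev β) g₀ T) (hβ : IsSelfAdjoint β) (k j : ι) :
    matB ψ ev β g₀ k j = (if k = j then totalRate ψ ev β g₀ j else 0) -
      if k = j then 0 else rate ψ ev β g₀ k j := by
  unfold matB
  by_cases h : k = j
  · subst h
    simp only [if_true, sub_zero]
    rw [totalRate, ← (tsum_off_diag (summable_rate hD k).hasSum k).tsum_eq]
    simp only [rate_symm hβ k]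
  · simp [h, Ne.symm h]

open Classical in
theorem l1Le_rate (hD : IsDefect (coupling ψ ev β) g₀ T) (j : ι) :
    L1Le (fun k => if k = j then 0 else rate ψ ev β g₀ k j) (totalRate ψ ev β g₀ j) := by
  have h := tsum_off_diag (summable_rate hD j).hasSum j
  have h0 : ∀ k, 0 ≤ if k = j then 0 else rate ψ ev β g₀ k j := fun k => by
    split_ifs
    · exact le_rfl
    · exact rate_nonneg k j
  intro s
  simp only [abs_of_nonneg (h0 _)]
  exact sum_le_hasSum s (fun k _ => h0 k) h

theorem l1Le_matB (hD : IsDefect (coupling ψ ev β) g₀ T) (hβ : IsSelfAdjoint β) (j : ι) :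
    L1Le (fun k => matB ψ ev β g₀ k j) 2 := by
  simp only [matB_eq hD hβ]
  refine ((l1Le_single j _).sub (l1Le_rate hD j)).mono ?_
  rw [abs_of_nonneg (totalRate_nonneg hD j)]
  linarith [totalRate_le hD j]

/-- The total rate is at most 1, so for |ε| ≤ 1 the diagonal stays nonnegative and the column is a
probability vector. -/
theorem l1Le_transferMat (hD : IsDefect (coupling ψ ev β) g₀ T) (hβ : IsSelfAdjoint β)
    (hε : |ε| ≤ 1) (j : ι) : L1Le (fun k => transferMat ψ ev β g₀ ε k j) 1 := by
  classical
  have h := (l1Le_single j (1 - ε ^ 2 * totalRate ψ ev β g₀ j)).add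
    ((l1Le_rate hD j).const_mul (ε ^ 2))
  have hε2 : ε ^ 2 ≤ 1 := (sq_le_one_iff_abs_le_one _).2 hε
  have h1 : 0 ≤ 1 - ε ^ 2 * totalRate ψ ev β g₀ j := by
    nlinarith [totalRate_le hD j, totalRate_nonneg hD j, sq_nonneg ε]
  refine (h.mono ?_).congr fun k => ?_
  · rw [abs_of_nonneg h1, abs_of_nonneg (sq_nonneg ε)]
    linarith
  · rw [transferMat, matB_eq hD hβ]
    by_cases hk : k = j <;> simp [hk]

theorem transfer_eq_act (hD : IsDefect (coupling ψ ev β) g₀ T) (hβ : IsSelfAdjoint β)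
    {p : ι → ℝ} {c : ℝ} (hp : L1Le p c) :
    transfer ψ ev β g₀ ε p = act (transferMat ψ ev β g₀ ε) p := by
  classical
  ext k
  have h1 : ∀ j, L1Le (fun k : ι => if k = j then (1 : ℝ) else 0) 1 := fun j => by
    simpa using l1Le_single j 1
  have h2 : ∀ j, L1Le (fun k => ε ^ 2 * matB ψ ev β g₀ k j) (|ε ^ 2| * 2) := fun j =>
    (l1Le_matB hD hβ j).const_mul _
  have h3 := act_sub_left h1 h2 hp k
  have h4 : act (fun k j : ι => if k = j then (1 : ℝ) else 0) p k = p k := by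
    simp [act]
  have h5 : act (fun k j => ε ^ 2 * matB ψ ev β g₀ k j) p k =
      ε ^ 2 * ∑' j, matB ψ ev β g₀ k j * p j := by
    simp only [act, mul_assoc, tsum_mul_left]
  rw [h4, h5] at h3
  exact h3.symm

variable {S : ℝ → H →L[ℂ] H}

theorem norm_propagator_sub_basis_le
    (hD : IsDefect (coupling ψ ev β) g₀ T) (hS : IsPropagator (coupling ψ ev β) g₀ ε S)
    (j : ι) : ‖S T (ψ j) - ψ j‖ ≤ |ε| := by
  have h := hS.norm_sub_le hD T 0 (ψ j)
  rwa [hS.apply_of_nonpos hD le_rfl, ψ.orthonormal.1 j, mul_one] at h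

/-- The off-diagonal mass is at most ‖S T ψ_j - ψ_j‖² ≤ ε². Unitarity makes the loss on the diagonal
equal to that mass, hence the factor 2. -/
theorem l1Le_trans_sub_one
    (hD : IsDefect (coupling ψ ev β) g₀ T) (hS : IsPropagator (coupling ψ ev β) g₀ ε S)
    (j : ι) :
    L1Le (fun k => trans ψ (S T) k j - (open Classical in if k = j then 1 else 0)) (2 * ε ^ 2) := by
  classical
  have h1 : L1Le (fun k => if k = j then 0 else trans ψ (S T) k j) (ε ^ 2) := by
    refine ((l1Le_norm_sq ψ (S T (ψ j) - ψ j)).mono ?_).of_abs_le fun k => ?_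
    · rw [← sq_abs ε]
      exact pow_le_pow_left₀ (norm_nonneg _) (norm_propagator_sub_basis_le hD hS j) 2
    · split_ifs with h
      · simp
      · rw [inner_sub_basis _ h, trans]
  have h2 := (tsum_off_diag (hasSum_trans (ψ := ψ) (fun x => hS.norm_apply hD T x) j) j).tsum_eq
  have h3 := h1.sub_single_tsum j
  rw [h2] at h3
  refine h3.congr fun k => ?_
  by_cases hk : k = j <;> simp [hk]

/-- Off the diagonal the entries are squared moduli of coordinates of x = S T ψ_j - ψ_j and, for the
transfer matrix, of its first-order part y. Since ‖x - y‖ ≤ ε² while ‖x‖ and ‖y‖ are at most |ε|,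
these differ by 2|ε|³ in ℓ¹. Equal column sums control the diagonal and double the constant. -/
theorem l1Le_trans_sub_transferMat
    (hD : IsDefect (coupling ψ ev β) g₀ T) (hS : IsPropagator (coupling ψ ev β) g₀ ε S)
    (hβ : IsSelfAdjoint β) (j : ι) :
    L1Le (fun k => trans ψ (S T) k j - transferMat ψ ev β g₀ ε k j) (4 * |ε| ^ 3) := by
  classical
  set A := firstOrder ψ ev β g₀ T (ψ j) with hA
  set y : H := (-Complex.I * ε) • A with hy
  have hyn : ‖y‖ ≤ |ε| := by
    have h := hD.norm_integral_le (ψ j)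
    rw [ψ.orthonormal.1 j] at h
    rw [hy, norm_smul]
    simp only [norm_mul, norm_neg, Complex.norm_I, one_mul, Complex.norm_real, Real.norm_eq_abs]
    exact mul_le_of_le_one_right (abs_nonneg _) h
  have hxy : ‖S T (ψ j) - ψ j - y‖ ≤ ε ^ 2 := by
    have h := hS.norm_sub_first_order_le hD (ψ j)
    rw [ψ.orthonormal.1 j, mul_one, ← sub_sub] at h
    exact h
  have h1 : L1Le (fun k => if k = j then 0 else
      trans ψ (S T) k j - ε ^ 2 * rate ψ ev β g₀ k j) (2 * |ε| ^ 3) := by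
    refine ((l1Le_norm_sq_sub ψ (S T (ψ j) - ψ j) y).mono ?_).of_abs_le fun k => ?_
    · calc _ ≤ ε ^ 2 * (|ε| + |ε|) :=
            mul_le_mul hxy (add_le_add (norm_propagator_sub_basis_le hD hS j) hyn)
              (by positivity) (sq_nonneg _)
        _ = 2 * |ε| ^ 3 := by rw [← sq_abs ε]; ring
    · split_ifs with h
      · simp
      · rw [inner_sub_basis _ h, trans, hy, inner_smul_right, norm_mul, mul_pow, hA,
          norm_sq_inner_firstOrder hD]
        simp
  have h2 := ((tsum_off_diag (hasSum_trans (ψ := ψ) (fun x => hS.norm_apply hD T x) j) j).sub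
    ((tsum_off_diag (summable_rate hD j).hasSum j).mul_left (ε ^ 2))).tsum_eq
  have h2' : ∑' k, (if k = j then 0 else
      trans ψ (S T) k j - ε ^ 2 * rate ψ ev β g₀ k j) =
      1 - trans ψ (S T) j j - ε ^ 2 * totalRate ψ ev β g₀ j := by
    rw [totalRate, ← h2]
    congr 1; ext k
    split_ifs <;> simp
  have h3 := h1.sub_single_tsum j
  rw [h2'] at h3
  refine (h3.mono (by linarith)).congr fun k => ?_
  rw [transferMat, matB_eq hD hβ]
  by_cases hk : k = j
  · simp only [hk, if_true]; ring
  · simp only [hk, if_false]; ring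

/-- Iterating the exact transition matrix or the transfer operator makes little difference. -/
theorem l1Le_iterate_sub
    (hD : IsDefect (coupling ψ ev β) g₀ T) (hS : IsPropagator (coupling ψ ev β) g₀ ε S)
    (hβ : IsSelfAdjoint β) (hε : |ε| ≤ 1) {p : ι → ℝ} {c : ℝ}
    (hp : L1Le p c) (n : ℕ) :
    L1Le ((act (trans ψ (S T)))^[n] p) c ∧ L1Le ((transfer ψ ev β g₀ ε)^[n] p) c ∧
      L1Le (fun k => (act (trans ψ (S T)))^[n] p k - (transfer ψ ev β g₀ ε)^[n] p k)
        (n * (4 * |ε| ^ 3) * c) := by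
  have hQ : ∀ j, L1Le (fun k => trans ψ (S T) k j) 1 := l1Le_trans (fun x => hS.norm_apply hD T x)
  have hT := l1Le_transferMat hD hβ hε
  induction n with
  | zero => exact ⟨hp, hp, fun s => by simp⟩
  | succ n ih =>
    -- With Q the exact and R the transfer matrix, Qp - Rq = (Q - R)p + R(p - q): a new error of one
    -- step plus the contracted old error.
    obtain ⟨h1, h2, h3⟩ := ih
    simp only [Function.iterate_succ_apply', transfer_eq_act hD hβ h2]
    refine ⟨(h1.act hQ zero_le_one).mono (one_mul c).le,
      (h2.act hT zero_le_one).mono (one_mul c).le, ?_⟩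
    have e1 := L1Le.act (l1Le_trans_sub_transferMat hD hS hβ) (by positivity) h1
    have e2 := L1Le.act hT zero_le_one h3
    refine ((e1.add e2).mono ?_).congr fun k => ?_
    · push_cast; linarith
    · rw [act_sub_left hQ hT h1, act_sub_right hT h1 h2]
      ring

end Transfer

/-! ### Sums of Chebyshev bounds. -/

section Sums

/-- Chebyshev weight: `1` at the origin and `min 1 (w / j²)` away from it. -/
def chebWeight (w : ℝ) (j : ℕ) : ℝ := if j = 0 then 1 else min 1 (w / (j : ℝ) ^ 2)

theorem chebWeight_le_one (w : ℝ) (j : ℕ) : chebWeight w j ≤ 1 := by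
  unfold chebWeight; split_ifs
  · exact le_rfl
  · exact min_le_left _ _

theorem chebWeight_nonneg {w : ℝ} (hw : 0 ≤ w) (j : ℕ) : 0 ≤ chebWeight w j := by
  unfold chebWeight; split_ifs
  · exact zero_le_one
  · exact le_min zero_le_one (by positivity)

/-- Splitting near √w, where w/j² drops below 1, leaves about √w terms bounded by 1 and a tail of
size about w/√w. -/
theorem sum_chebWeight_le {w : ℝ} (hw : 0 ≤ w) (N : ℕ) :
    ∑ j ∈ Finset.range N, chebWeight w j ≤ 2 * √w + 2 := by
  set s : ℕ := ⌊√w⌋₊ + 1 with hs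
  have hs0 : s ≠ 0 := by omega
  have h1 : √w ≤ s := by rw [hs]; push_cast; exact (Nat.lt_floor_add_one _).le
  have h2 : (s : ℝ) ≤ √w + 1 := by
    rw [hs]; push_cast
    linarith [Nat.floor_le (Real.sqrt_nonneg w)]
  have hspos : (0 : ℝ) < s := by positivity
  have h3 : w / s ≤ √w := by
    rw [div_le_iff₀ hspos]
    nlinarith [Real.mul_self_sqrt hw, Real.sqrt_nonneg w]
  have hsub : Finset.range N ⊆ Finset.range s ∪ (insert s (Finset.Ioc s (max s N))) := by
    intro j hj
    simp only [Finset.mem_range, Finset.mem_union, Finset.mem_insert, Finset.mem_Ioc] at hj ⊢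
    have := le_max_right s N
    omega
  calc ∑ j ∈ Finset.range N, chebWeight w j
      ≤ ∑ j ∈ Finset.range s ∪ (insert s (Finset.Ioc s (max s N))), chebWeight w j :=
        Finset.sum_le_sum_of_subset_of_nonneg hsub fun j _ _ => chebWeight_nonneg hw j
    _ ≤ ∑ j ∈ Finset.range s, chebWeight w j +
        ∑ j ∈ insert s (Finset.Ioc s (max s N)), chebWeight w j := by
        rw [← Finset.sum_union_inter]
        exact le_add_of_nonneg_right (Finset.sum_nonneg fun j _ => chebWeight_nonneg hw j)
    _ ≤ ∑ j ∈ Finset.range s, 1 + (1 + ∑ j ∈ Finset.Ioc s (max s N), w * ((j : ℝ) ^ 2)⁻¹) := by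
        rw [Finset.sum_insert (by simp)]
        refine add_le_add (Finset.sum_le_sum fun j _ => chebWeight_le_one w j)
          (add_le_add (chebWeight_le_one w s) (Finset.sum_le_sum fun j hj => ?_))
        have hj0 : j ≠ 0 := by
          have := (Finset.mem_Ioc.1 hj).1
          omega
        rw [chebWeight, if_neg hj0, ← div_eq_mul_inv]
        exact min_le_right _ _
    _ ≤ s + (1 + w * (1 / s)) := by
        rw [← Finset.mul_sum]
        have h4 := sum_Ioc_inv_sq_le_sub (α := ℝ) hs0 (le_max_left s N)
        have h5 : (0 : ℝ) ≤ ((max s N : ℕ) : ℝ)⁻¹ := by positivity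
        have h6 : ∑ j ∈ Finset.Ioc s (max s N), ((j : ℝ) ^ 2)⁻¹ ≤ 1 / s := by
          rw [one_div]; linarith
        simp only [Finset.sum_const, Finset.card_range, nsmul_eq_mul, mul_one]
        have := mul_le_mul_of_nonneg_left h6 hw
        linarith
    _ ≤ 2 * √w + 2 := by
        rw [mul_one_div]; linarith

/-- Each side of `n` contributes one copy of the previous sum. Truncated subtraction gives distance
0 to both `l = n` and `l = n + 1`, which adds one more unit. -/
theorem sum_chebWeight_dist_le {w : ℝ} (hw : 0 ≤ w) (n K : ℕ) :
    ∑ l ∈ Finset.range K, chebWeight w (if l < n then n - l else l - n - 1) ≤ 4 * √w + 5 := by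
  have h0 := fun j => chebWeight_nonneg hw j
  have h1 : ∑ l ∈ Finset.range n, chebWeight w (n - l) ≤ 2 * √w + 2 := by
    refine le_trans ?_ (sum_chebWeight_le hw (n + 1))
    rw [Finset.sum_range_succ', ← Finset.sum_range_reflect (fun j => chebWeight w (j + 1))]
    refine (Finset.sum_le_sum fun l hl => le_of_eq ?_).trans (le_add_of_nonneg_right (h0 0))
    have := Finset.mem_range.1 hl
    congr 1; omega
  have h2 : ∑ l ∈ Finset.range (K + 1), chebWeight w (l - 1) ≤ 1 + (2 * √w + 2) := by
    rw [Finset.sum_range_succ', add_comm]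
    exact add_le_add (chebWeight_le_one w _) (sum_chebWeight_le hw K)
  calc ∑ l ∈ Finset.range K, chebWeight w (if l < n then n - l else l - n - 1)
      ≤ ∑ l ∈ Finset.range (n + (K + 1)), chebWeight w (if l < n then n - l else l - n - 1) :=
        Finset.sum_le_sum_of_subset_of_nonneg
          (Finset.range_mono (by omega)) fun j _ _ => h0 _
    _ = ∑ l ∈ Finset.range n, chebWeight w (n - l) +
        ∑ l ∈ Finset.range (K + 1), chebWeight w (l - 1) := by
        rw [Finset.sum_range_add]
        congr 1
        · exact Finset.sum_congr rfl fun l hl => by rw [if_pos (Finset.mem_range.1 hl)]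
        · refine Finset.sum_congr rfl fun l _ => ?_
          rw [if_neg (by omega)]
          congr 1; omega
    _ ≤ 4 * √w + 5 := by linarith

end Sums

/-! ### Fluctuations of the number of defects before time t. -/

section Counting

/-- Difference of the indicators of `l`-th defect being finished by time `t` and of `l < n`. -/
def miscount (T : ℝ) (t : ℝ) (n l : ℕ) (d : ℕ → ℝ) : ℝ :=
  (if defectEnd T d l ≤ t then 1 else 0) - (if l < n then 1 else 0)

theorem abs_miscount_le_one (T t : ℝ) (n l : ℕ) (d : ℕ → ℝ) : |miscount T t n l d| ≤ 1 := by
  unfold miscount; split_ifs <;> simp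

theorem measurable_defectEnd (T : ℝ) (l : ℕ) : Measurable fun d : ℕ → ℝ => defectEnd T d l := by
  unfold defectEnd
  refine Finset.measurable_sum _ fun i _ => ?_
  have h : Measurable fun d : ℕ → ℝ => d i := measurable_pi_apply i
  exact h.add_const T

theorem measurable_miscount (T t : ℝ) (n l : ℕ) : Measurable (miscount T t n l) := by
  refine Measurable.sub (Measurable.ite ?_ measurable_const measurable_const) measurable_const
  exact measurableSet_le (measurable_defectEnd T l) measurable_const

variable {Ω : Type*} [MeasurableSpace Ω] {μ : Measure Ω} [IsProbabilityMeasure μ]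
  {d : ℕ → Ω → ℝ}

theorem integral_defectEnd (hident : ∀ l, IdentDistrib (d l) (d 0) μ μ) (h2 : MemLp (d 0) 2 μ)
    (T : ℝ) (l : ℕ) :
    ∫ ω, defectEnd T (fun i => d i ω) l ∂μ = l * (T + ∫ ω, d 0 ω ∂μ) := by
  have hi : ∀ i, Integrable (d i) μ := fun i =>
    ((hident i).memLp_iff.2 h2).integrable one_le_two
  have hiT : ∀ i, Integrable (fun ω => d i ω + T) μ := fun i => (hi i).add (integrable_const T)
  unfold defectEnd
  rw [integral_finsetSum _ fun i _ => hiT i]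
  have : ∀ i, ∫ ω, (d i ω + T) ∂μ = T + ∫ ω, d 0 ω ∂μ := fun i => by
    rw [integral_add (hi i) (integrable_const T), (hident i).integral_eq]
    simp [add_comm]
  simp only [this, Finset.sum_const, Finset.card_range, nsmul_eq_mul]

theorem memLp_defectEnd (hident : ∀ l, IdentDistrib (d l) (d 0) μ μ) (h2 : MemLp (d 0) 2 μ)
    (T : ℝ) (l : ℕ) : MemLp (fun ω => defectEnd T (fun i => d i ω) l) 2 μ := by
  unfold defectEnd
  exact memLp_finsetSum _ fun i _ => ((hident i).memLp_iff.2 h2).add (memLp_const T)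

theorem variance_defectEnd (hindep : iIndepFun d μ) (hident : ∀ l, IdentDistrib (d l) (d 0) μ μ)
    (h2 : MemLp (d 0) 2 μ) (T : ℝ) (l : ℕ) :
    variance (fun ω => defectEnd T (fun i => d i ω) l) μ = l * variance (d 0) μ := by
  have hm : ∀ i, MemLp (fun ω => d i ω + T) 2 μ := fun i =>
    ((hident i).memLp_iff.2 h2).add (memLp_const T)
  have h := IndepFun.variance_sum (μ := μ) (X := fun i ω => d i ω + T) (s := Finset.range l)
    (fun i _ => hm i) (fun i _ j _ hij =>
      (hindep.indepFun hij).comp (measurable_id.add_const T) (measurable_id.add_const T))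
  have hv : ∀ i, variance (fun ω => d i ω + T) μ = variance (d 0) μ := fun i => by
    rw [variance_add_const ((hident i).memLp_iff.2 h2).aestronglyMeasurable, (hident i).variance_eq]
  simp only [hv, Finset.sum_const, Finset.card_range, nsmul_eq_mul] at h
  rw [← h]
  congr 1
  ext ω
  simp [defectEnd]

/-- The end time of mean lc can be on the wrong side of t only by deviating by at least c times the
index distance, and Chebyshev's inequality applies with variance l·Var(d_0). As nc ≤ t < (n+1)c, the
distance is `n - l` below n but `l - n - 1` above. -/
theorem integral_abs_miscount_le (hdmeas : ∀ l, Measurable (d l)) (hindep : iIndepFun d μ)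
    (hident : ∀ l, IdentDistrib (d l) (d 0) μ μ)
    (h2 : MemLp (d 0) 2 μ) {T c t : ℝ} (hc : c = T + ∫ ω, d 0 ω ∂μ) (hc0 : 0 < c) (ht : 0 ≤ t)
    {K l : ℕ} (hl : l ≤ K) :
    ∫ ω, |miscount T t ⌊t / c⌋₊ l (fun i => d i ω)| ∂μ ≤
      chebWeight (K * variance (d 0) μ / c ^ 2)
        (if l < ⌊t / c⌋₊ then ⌊t / c⌋₊ - l else l - ⌊t / c⌋₊ - 1) := by
  set n := ⌊t / c⌋₊ with hn
  set j := if l < n then n - l else l - n - 1 with hj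
  have hmeas : Measurable fun ω => miscount T t n l (fun i => d i ω) :=
    (measurable_miscount T t n l).comp (measurable_pi_lambda _ hdmeas)
  have hint : Integrable (fun ω => |miscount T t n l (fun i => d i ω)|) μ :=
    Integrable.of_bound hmeas.abs.aestronglyMeasurable 1
      (Filter.Eventually.of_forall fun ω => by simpa using abs_miscount_le_one T t n l _)
  have hone : ∫ ω, |miscount T t n l (fun i => d i ω)| ∂μ ≤ 1 :=
    (integral_mono hint (integrable_const 1) fun ω => abs_miscount_le_one T t n l _).trans
      (by simp)
  unfold chebWeight
  split_ifs with hj0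
  · exact hone
  refine le_min hone ?_
  have hjpos : (0 : ℝ) < j := by positivity
  have hV : 0 ≤ variance (d 0) μ := variance_nonneg _ _
  set A : Set Ω := {ω | c * j ≤ |defectEnd T (fun i => d i ω) l -
    ∫ ω, defectEnd T (fun i => d i ω) l ∂μ|} with hA
  have hτm : Measurable fun ω => defectEnd T (fun i => d i ω) l :=
    (measurable_defectEnd T l).comp (measurable_pi_lambda _ hdmeas)
  have hAm : MeasurableSet A := measurableSet_le measurable_const (hτm.sub_const _).abs
  have hn1 : n * c ≤ t := by
    have := Nat.floor_le (div_nonneg ht hc0.le)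
    rwa [← hn, le_div_iff₀ hc0] at this
  have hn2 : t < (n + 1) * c := by
    have := Nat.lt_floor_add_one (t / c)
    rwa [← hn, div_lt_iff₀ hc0] at this
  have hpt : ∀ ω, |miscount T t n l (fun i => d i ω)| ≤ A.indicator (fun _ => (1 : ℝ)) ω := by
    intro ω
    by_cases hω : ω ∈ A
    · rw [Set.indicator_of_mem hω]
      exact abs_miscount_le_one T t n l _
    · rw [Set.indicator_of_notMem hω]
      simp only [hA, Set.mem_ofPred_eq, not_le, integral_defectEnd hident h2, ← hc, abs_lt] at hω
      refine le_of_eq (abs_eq_zero.2 ?_)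
      unfold miscount
      by_cases hln : l < n
      · have hjl : (l : ℝ) + j = n := by
          rw [hj, if_pos hln]; exact_mod_cast Nat.add_sub_cancel' hln.le
        rw [if_pos hln, if_pos (by nlinarith [hω.2]), sub_self]
      · have hjl : (l : ℝ) = n + 1 + j := by
          rw [hj, if_neg hln] at hj0 ⊢
          have : l = n + 1 + (l - n - 1) := by omega
          exact_mod_cast this
        rw [if_neg hln, if_neg (by nlinarith [hω.1]), sub_self]
  have hcheb := meas_ge_le_variance_div_sq (memLp_defectEnd hident h2 T l)
    (mul_pos hc0 hjpos)
  rw [variance_defectEnd hindep hident h2] at hcheb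
  calc ∫ ω, |miscount T t n l (fun i => d i ω)| ∂μ ≤ ∫ ω, A.indicator (fun _ => (1 : ℝ)) ω ∂μ :=
        integral_mono hint ((integrable_const 1).indicator hAm) hpt
    _ = (μ A).toReal := by
        rw [integral_indicator hAm]; simp [Measure.real]
    _ ≤ l * variance (d 0) μ / (c * j) ^ 2 := ENNReal.toReal_le_of_le_ofReal (by positivity) hcheb
    _ ≤ K * variance (d 0) μ / c ^ 2 / (j : ℝ) ^ 2 := by
        rw [mul_pow, div_div]
        gcongr

end Counting

/-! ### Measurability of the state and its independence of the next waiting time. -/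

section StateMeasurability

variable {H : Type*} [NormedAddCommGroup H] [InnerProductSpace ℂ H] [CompleteSpace H] {ι : Type*}
  (ψ : HilbertBasis ι ℂ H) (ev : ι → ℝ) (U : H →L[ℂ] H) (T : ℝ)

theorem continuous_stateAt (n : ℕ) :
    Continuous fun p : (ℕ → ℝ) × H => stateAt ψ ev U T p.1 p.2 n := by
  induction n with
  | zero => exact continuous_snd
  | succ n ih =>
    have h : Continuous fun p : (ℕ → ℝ) × H => flow ψ ev (-p.1 n) (stateAt ψ ev U T p.1 p.2 n) :=
      (continuous_flow ψ ev).comp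
        (((continuous_apply n).comp continuous_fst).neg.prodMk ih)
    exact (flow ψ ev (-T)).continuous.comp (U.continuous.comp h)

theorem stateAt_congr {d d' : ℕ → ℝ} {n : ℕ} (h : ∀ i < n, d i = d' i) (x : H) :
    stateAt ψ ev U T d x n = stateAt ψ ev U T d' x n := by
  induction n with
  | zero => rfl
  | succ n ih =>
    rw [stateAt, stateAt, ih fun i hi => h i (hi.trans n.lt_succ_self), h n n.lt_succ_self]

theorem miscount_congr {d d' : ℕ → ℝ} {n : ℕ} (h : ∀ i < n, d i = d' i) (t : ℝ) (m : ℕ) :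
    miscount T t m n d = miscount T t m n d' := by
  have : defectEnd T d n = defectEnd T d' n :=
    Finset.sum_congr rfl fun i hi => by rw [h i (Finset.mem_range.1 hi)]
  rw [miscount, miscount, this]

/-- Extension of a finite sequence by zero. -/
def extendZero (n : ℕ) (y : Finset.range n → ℝ) (i : ℕ) : ℝ :=
  if h : i ∈ Finset.range n then y ⟨i, h⟩ else 0

theorem measurable_extendZero (n : ℕ) : Measurable (extendZero n) := by
  refine measurable_pi_lambda _ fun i => ?_
  unfold extendZero
  by_cases h : i ∈ Finset.range n
  · simp only [h, dif_pos]; exact measurable_pi_apply _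
  · simp only [h, dif_neg, not_false_eq_true]; exact measurable_const

variable {Ω : Type*} [MeasurableSpace Ω] {μ : Measure Ω} [IsProbabilityMeasure μ]
  {d : ℕ → Ω → ℝ} [MeasurableSpace H] [BorelSpace H] [SecondCountableTopology H]

theorem measurable_stateAt (hdmeas : ∀ l, Measurable (d l)) {X : Ω → H} (hX : Measurable X)
    (n : ℕ) : Measurable fun ω => stateAt ψ ev U T (fun i => d i ω) (X ω) n :=
  (continuous_stateAt ψ ev U T n).measurable.comp
    ((measurable_pi_lambda _ hdmeas).prodMk hX)

/-- The state before a waiting time, and functions of the past, are independent of that waiting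
time. -/
theorem indepFun_miscount_stateAt (hdmeas : ∀ l, Measurable (d l)) (hindep : iIndepFun d μ)
    {X : Ω → H} (hX : Measurable X) (hXd : IndepFun X (fun ω l => d l ω) μ) (t : ℝ) (m n : ℕ) :
    IndepFun (fun ω => (miscount T t m n (fun i => d i ω),
      stateAt ψ ev U T (fun i => d i ω) (X ω) n)) (d n) μ ∧
    IndepFun (fun ω => ((1 : ℝ), stateAt ψ ev U T (fun i => d i ω) (X ω) n)) (d n) μ := by
  -- The state and the weight are functions of the initial state and the first `n` waiting times
  -- alone. Both are rewritten through this finite past.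
  set Y : Ω → Finset.range n → ℝ := fun ω i => d i ω with hY
  have hYm : Measurable Y := measurable_pi_lambda _ fun i => hdmeas i
  have h2 : IndepFun Y (d n) μ := by
    have h := hindep.indepFun_finset (Finset.range n) {n} (by simp) hdmeas
    exact h.comp (φ := id) (ψ := fun z : ({n} : Finset ℕ) → ℝ => z ⟨n, by simp⟩) measurable_id
      (measurable_pi_apply _)
  have h1 : IndepFun X (fun ω => (Y ω, d n ω)) μ :=
    hXd.comp (φ := id) (ψ := fun z : ℕ → ℝ => ((fun i : Finset.range n => z i), z n))
      measurable_id ((measurable_pi_lambda _ fun i => measurable_pi_apply _).prodMk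
        (measurable_pi_apply _))
  have h3 := indepFun_prod_left hX hYm (hdmeas n) h1 h2
  have hext : ∀ ω, ∀ i < n, d i ω = extendZero n (Y ω) i := fun ω i hi => by
    simp [extendZero, hi, hY]
  have hs : ∀ ω, stateAt ψ ev U T (fun i => d i ω) (X ω) n =
      stateAt ψ ev U T (extendZero n (Y ω)) (X ω) n := fun ω =>
    stateAt_congr ψ ev U T (hext ω) _
  have hc : ∀ ω, miscount T t m n (fun i => d i ω) = miscount T t m n (extendZero n (Y ω)) :=
    fun ω => miscount_congr T (hext ω) t m
  have hme : Measurable fun p : H × (Finset.range n → ℝ) => extendZero n p.2 :=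
    (measurable_extendZero n).comp measurable_snd
  have hms : Measurable fun p : H × (Finset.range n → ℝ) =>
      stateAt ψ ev U T (extendZero n p.2) p.1 n :=
    (continuous_stateAt ψ ev U T n).measurable.comp (hme.prodMk measurable_fst)
  simp only [hs, hc]
  exact ⟨h3.comp (φ := fun p : H × (Finset.range n → ℝ) =>
      (miscount T t m n (extendZero n p.2), stateAt ψ ev U T (extendZero n p.2) p.1 n))
      (((measurable_miscount T t m n).comp hme).prodMk hms) measurable_id,
    h3.comp (φ := fun p : H × (Finset.range n → ℝ) =>
      ((1 : ℝ), stateAt ψ ev U T (extendZero n p.2) p.1 n))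
      (measurable_const.prodMk hms) measurable_id⟩

end StateMeasurability

/-! ### Collecting the error terms. -/

section Estimate

theorem sqrt_add_le_sqrt_add {x y : ℝ} (hx : 0 ≤ x) (hy : 0 ≤ y) : √(x + y) ≤ √x + √y :=
  Real.sqrt_le_iff.2 ⟨by positivity, by
    nlinarith [Real.sq_sqrt hx, Real.sq_sqrt hy, mul_nonneg (Real.sqrt_nonneg x) (Real.sqrt_nonneg y)]⟩

/-- Numerical estimate of the total error. -/
theorem error_le {A ε t c T V : ℝ} {n K : ℕ} (hA : 0 ≤ A) (hε : |ε| ≤ 1) (ht : 0 ≤ t)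
    (hc : 0 < c) (hT : 0 < T) (hV : 0 ≤ V) (hn : (n : ℝ) ≤ t / c) (hK : (K : ℝ) ≤ t / T + 1) :
    2 * |ε| * A + 2 * ε ^ 2 * ((4 * √(K * V / c ^ 2) + 5) * A) + n * (4 * |ε| ^ 3) * A ≤
      (12 + 8 * √(V / (T * c ^ 2)) + 8 * √(V / c ^ 2) + 4 / c) * A *
        max (t * |ε| ^ 3) (|ε| ^ ((4 : ℝ) / 5)) := by
  set m := max (t * |ε| ^ 3) (|ε| ^ ((4 : ℝ) / 5)) with hm
  set a := |ε| with ha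
  have ha0 : 0 ≤ a := abs_nonneg _
  have h1 : a ≤ m := by
    refine le_trans ?_ (le_max_right _ _)
    rcases ha0.eq_or_lt with h | h
    · rw [← h]; positivity
    · simpa using Real.rpow_le_rpow_of_exponent_ge h hε (by norm_num : (4 : ℝ) / 5 ≤ 1)
  have h2 : t * a ^ 3 ≤ m := le_max_left _ _
  have hm0 : 0 ≤ m := ha0.trans h1
  have hsq : ε ^ 2 = a ^ 2 := (sq_abs ε).symm
  have h3 : a ^ 2 ≤ m := (by nlinarith : a ^ 2 ≤ a).trans h1
  -- The fluctuation term is the geometric mean of |ε| and t|ε|³, both at most `m`.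
  have h4 : a ^ 2 * √t ≤ m := by
    refine le_of_sq_le_sq ?_ hm0
    rw [mul_pow, Real.sq_sqrt ht]
    calc (a ^ 2) ^ 2 * t = a * (t * a ^ 3) := by ring
      _ ≤ m * m := mul_le_mul h1 h2 (by positivity) hm0
      _ = m ^ 2 := by ring
  -- The bound `K ≤ t / T + 1` separates the growth in t from a constant.
  have h5 : √(K * V / c ^ 2) ≤ √(V / (T * c ^ 2)) * √t + √(V / c ^ 2) := by
    rw [← Real.sqrt_mul (by positivity)]
    refine (Real.sqrt_le_sqrt ?_).trans (sqrt_add_le_sqrt_add (by positivity) (by positivity))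
    calc K * V / c ^ 2 ≤ (t / T + 1) * V / c ^ 2 := by gcongr
      _ = V / (T * c ^ 2) * t + V / c ^ 2 := by field_simp
  have h6 : n * (4 * a ^ 3) ≤ 4 / c * m := by
    calc n * (4 * a ^ 3) ≤ t / c * (4 * a ^ 3) := by gcongr
      _ = 4 / c * (t * a ^ 3) := by ring
      _ ≤ 4 / c * m := by gcongr
  have h7 : a ^ 2 * √(K * V / c ^ 2) ≤ (√(V / (T * c ^ 2)) + √(V / c ^ 2)) * m := by
    calc a ^ 2 * √(K * V / c ^ 2) ≤ a ^ 2 * (√(V / (T * c ^ 2)) * √t + √(V / c ^ 2)) := by gcongr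
      _ = √(V / (T * c ^ 2)) * (a ^ 2 * √t) + √(V / c ^ 2) * a ^ 2 := by ring
      _ ≤ √(V / (T * c ^ 2)) * m + √(V / c ^ 2) * m := by gcongr
      _ = _ := by ring
  have h8 : 2 * a + 2 * a ^ 2 * (4 * √(K * V / c ^ 2) + 5) + n * (4 * a ^ 3) ≤
      (12 + 8 * √(V / (T * c ^ 2)) + 8 * √(V / c ^ 2) + 4 / c) * m := by linarith
  rw [hsq]
  calc _ = (2 * a + 2 * a ^ 2 * (4 * √(K * V / c ^ 2) + 5) + n * (4 * a ^ 3)) * A := by ring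
    _ ≤ (12 + 8 * √(V / (T * c ^ 2)) + 8 * √(V / c ^ 2) + 4 / c) * m * A :=
        mul_le_mul_of_nonneg_right h8 hA
    _ = _ := by ring

end Estimate

/-! ### Powers at a fixed time along one realisation. -/

section PathwisePower

variable {H : Type*} [NormedAddCommGroup H] [InnerProductSpace ℂ H] [CompleteSpace H] {ι : Type*}
  {H₀ : H →ₗ.[ℂ] H} {ψ : HilbertBasis ι ℂ H} {ev : ι → ℝ} {β : H →L[ℂ] H} {ε : ℝ}
  {T : ℝ} {g₀ : ℝ → ℝ} {S : ℝ → H →L[ℂ] H} {d : ℕ → ℝ} {φ₀ : H} {φ : ℝ → H} {t : ℝ}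

/-- The l-th end time is at most t exactly when l < i + 1, so both indicator sums telescope.
Stopping at i + 1 rather than i is what makes the l-th weight depend only on waiting times before
d_l. -/
theorem sum_miscount_mul {n K i : ℕ} (hT : 0 < T) (hd : ∀ i, 0 ≤ d i) (hn : n ≤ K) (hi : i + 1 ≤ K)
    (h1 : defectEnd T d i ≤ t) (h2 : t < defectEnd T d (i + 1)) (p : ℕ → ℝ) :
    ∑ l ∈ Finset.range K, miscount T t n l d * (p (l + 1) - p l) = p (i + 1) - p n := by
  have key : ∀ m ≤ K, ∑ l ∈ Finset.range K, (if l < m then (1 : ℝ) else 0) * (p (l + 1) - p l) =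
      p m - p 0 := by
    intro m hm
    simp only [ite_mul, one_mul, zero_mul]
    rw [← Finset.sum_filter, ← Finset.sum_range_sub]
    congr 1
    ext l
    simp only [Finset.mem_filter, Finset.mem_range]
    omega
  have hiff : ∀ l, defectEnd T d l ≤ t ↔ l < i + 1 := by
    intro l
    constructor
    · intro h
      by_contra hl
      exact absurd (h2.trans_le (defectEnd_mono hT hd (not_lt.1 hl))) (not_lt.2 h)
    · intro h
      exact (defectEnd_mono hT hd (Nat.lt_succ_iff.1 h)).trans h1
  simp only [miscount, hiff, sub_mul, Finset.sum_sub_distrib, key _ hi, key _ hn]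
  ring

theorem lt_of_defectEnd_le (hT : 0 < T) (hd : ∀ i, 0 ≤ d i) {i : ℕ} {K : ℕ} (hK : t < K * T)
    (h1 : defectEnd T d i ≤ t) : i < K := by
  by_contra h
  have := defectEnd_mono hT hd (not_lt.1 h)
  have h3 := mul_le_defectEnd (T := T) hd K
  linarith

/-- The power at time `t` differs by `O(ε)` from the one after the next defect. -/
theorem IsSolution.l1Le_power_sub
    (hφ : IsSolution H₀ β ε (train T g₀ d) φ₀ φ) (hdom : ∀ j, ψ j ∈ H₀.domain)
    (heig : ∀ j, H₀ ⟨ψ j, hdom j⟩ = (ev j : ℂ) • ψ j)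
    (hD : IsDefect (coupling ψ ev β) g₀ T)
    (hS : IsPropagator (coupling ψ ev β) g₀ ε S) (hd : ∀ i, 0 ≤ d i) (ht : 0 ≤ t) {n K : ℕ}
    (hn : n ≤ K) (hK : t < K * T) :
    L1Le (fun k => ‖inner ℂ (ψ k) (φ t)‖ ^ 2 -
        ‖inner ℂ (ψ k) (stateAt ψ ev (S T) T d φ₀ n)‖ ^ 2 -
        ∑ l ∈ Finset.range K, miscount T t n l d *
          (‖inner ℂ (ψ k) (stateAt ψ ev (S T) T d φ₀ (l + 1))‖ ^ 2 -
            ‖inner ℂ (ψ k) (stateAt ψ ev (S T) T d φ₀ l)‖ ^ 2)) (2 * |ε| * ‖φ₀‖ ^ 2) := by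
  obtain ⟨i, h1, h2⟩ := exists_defectEnd_le_lt hD.pos hd ht
  have hi := lt_of_defectEnd_le hD.pos hd hK h1
  have hU : ∀ x, ‖S T x‖ = ‖x‖ := fun x => hS.norm_apply hD T x
  set y := flow ψ ev (-d i) (stateAt ψ ev (S T) T d φ₀ i) with hy
  have hyn : ‖y‖ = ‖φ₀‖ := by
    rw [hy, LinearIsometryEquiv.norm_map, norm_stateAt ψ ev hU]
  -- The partial passage through the current defect is compared with the full one; a negative time
  -- argument means that t still lies in the waiting period. The free flow afterwards does not
  -- change moduli.
  have h := l1Le_norm_sq_sub ψ (S (t - onset T d i) y) (S T y)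
  refine (h.mono ?_).congr fun k => ?_
  · rw [hS.norm_apply hD, hS.norm_apply hD, hyn]
    have := hS.norm_sub_le hD (t - onset T d i) T y
    rw [hyn] at this
    nlinarith [norm_nonneg φ₀]
  · rw [sum_miscount_mul hD.pos hd hn hi h1 h2
      (fun l => ‖inner ℂ (ψ k) (stateAt ψ ev (S T) T d φ₀ l)‖ ^ 2),
      hφ.eq_propagator hdom heig hD hS hd i ⟨h1, h2.le⟩, norm_inner_flow,
      hφ.eq_stateAt hdom heig hD hS hd i, ← hy, stateAt, norm_inner_flow]
    ring

/-- The squared coordinates of the solution as an explicit function of the waiting times and the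
initial state. -/
def observed (ψ : HilbertBasis ι ℂ H) (ev : ι → ℝ) (S : ℝ → H →L[ℂ] H) (T t : ℝ) (K : ℕ) (k : ι)
    (p : (ℕ → ℝ) × H) : ℝ :=
  ∑ l ∈ Finset.range K, if defectEnd T p.1 l ≤ t ∧ t < defectEnd T p.1 (l + 1) then
    ‖inner ℂ (ψ k) (S (t - onset T p.1 l)
      (flow ψ ev (-p.1 l) (stateAt ψ ev (S T) T p.1 p.2 l)))‖ ^ 2 else 0

/-- This formula supplies measurability in ω of the observed power, and the second bound its
integrability. -/
theorem IsSolution.eq_observed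
    (hφ : IsSolution H₀ β ε (train T g₀ d) φ₀ φ) (hdom : ∀ j, ψ j ∈ H₀.domain)
    (heig : ∀ j, H₀ ⟨ψ j, hdom j⟩ = (ev j : ℂ) • ψ j)
    (hD : IsDefect (coupling ψ ev β) g₀ T)
    (hS : IsPropagator (coupling ψ ev β) g₀ ε S) (hd : ∀ i, 0 ≤ d i) (ht : 0 ≤ t) {K : ℕ}
    (hK : t < K * T) (k : ι) :
    ‖inner ℂ (ψ k) (φ t)‖ ^ 2 = observed ψ ev S T t K k (d, φ₀) ∧
      ‖inner ℂ (ψ k) (φ t)‖ ^ 2 ≤ ‖φ₀‖ ^ 2 := by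
  obtain ⟨i, h1, h2⟩ := exists_defectEnd_le_lt hD.pos hd ht
  have hi := lt_of_defectEnd_le hD.pos hd hK h1
  have hU : ∀ x, ‖S T x‖ = ‖x‖ := fun x => hS.norm_apply hD T x
  have he := hφ.eq_propagator hdom heig hD hS hd i ⟨h1, h2.le⟩
  rw [hφ.eq_stateAt hdom heig hD hS hd i] at he
  constructor
  · rw [observed, Finset.sum_eq_single_of_mem i (Finset.mem_range.2 hi), if_pos ⟨h1, h2⟩, he,
      norm_inner_flow]
    intro l _ hl
    refine if_neg fun h => ?_
    rcases lt_or_gt_of_ne hl with hli | hli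
    · exact absurd (h.2.trans_le (defectEnd_mono hD.pos hd (Nat.succ_le_of_lt hli))) (not_lt.2 h1)
    · exact absurd (h2.trans_le (defectEnd_mono hD.pos hd (Nat.succ_le_of_lt hli))) (not_lt.2 h.1)
  · refine pow_le_pow_left₀ (norm_nonneg _) ?_ 2
    refine (norm_inner_le_norm _ _).trans_eq ?_
    rw [ψ.orthonormal.1 k, one_mul, he, LinearIsometryEquiv.norm_map, hS.norm_apply hD,
      LinearIsometryEquiv.norm_map, norm_stateAt ψ ev hU]

theorem measurable_observed [MeasurableSpace H] [BorelSpace H] [SecondCountableTopology H]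
    (hD : IsDefect (coupling ψ ev β) g₀ T)
    (hS : IsPropagator (coupling ψ ev β) g₀ ε S) (K : ℕ) (k : ι) :
    Measurable (observed ψ ev S T t K k) := by
  have hend : ∀ l, Measurable fun p : (ℕ → ℝ) × H => defectEnd T p.1 l := fun l =>
    (measurable_defectEnd T l).comp measurable_fst
  refine Finset.measurable_sum _ fun l _ => Measurable.ite ?_ ?_ measurable_const
  · exact (measurableSet_le (hend l) measurable_const).inter
      (measurableSet_lt measurable_const (hend (l + 1)))
  · have h1 : Continuous fun p : (ℕ → ℝ) × H => flow ψ ev (-p.1 l)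
        (stateAt ψ ev (S T) T p.1 p.2 l) :=
      (continuous_flow ψ ev).comp
        (((continuous_apply l).comp continuous_fst).neg.prodMk (continuous_stateAt ψ ev (S T) T l))
    have h2 : Measurable fun p : (ℕ → ℝ) × H => t - onset T p.1 l := by
      simp only [onset_eq]
      exact measurable_const.sub ((hend l).add ((measurable_pi_apply l).comp measurable_fst))
    have h3 : Measurable fun p : (ℕ → ℝ) × H => S (t - onset T p.1 l)
        (flow ψ ev (-p.1 l) (stateAt ψ ev (S T) T p.1 p.2 l)) :=
      (hS.continuous hD).measurable.comp (h2.prodMk h1.measurable)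
    have h4 : Continuous fun x : H => ‖inner ℂ (ψ k) x‖ ^ 2 := by fun_prop
    exact h4.measurable.comp h3

end PathwisePower

section Integrability

variable {H : Type*} [NormedAddCommGroup H] [InnerProductSpace ℂ H] [MeasurableSpace H]
  [BorelSpace H] {ι : Type*} {Ω : Type*} [MeasurableSpace Ω] {μ : Measure Ω}
  {ψ : HilbertBasis ι ℂ H} {X : Ω → H}

theorem integrable_mul_norm_sq_inner {Y : Ω → H} (hY : Measurable Y)
    (hYX : ∀ ω, ‖Y ω‖ = ‖X ω‖) (hX2 : Integrable (fun ω => ‖X ω‖ ^ 2) μ) {c : Ω → ℝ}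
    (hc : Measurable c) (hc1 : ∀ ω, |c ω| ≤ 1) (k : ι) :
    Integrable (fun ω => c ω * ‖inner ℂ (ψ k) (Y ω)‖ ^ 2) μ := by
  have h4 : Continuous fun x : H => ‖inner ℂ (ψ k) x‖ ^ 2 := by fun_prop
  refine hX2.mono' (hc.mul (h4.measurable.comp hY)).aestronglyMeasurable
    (Filter.Eventually.of_forall fun ω => ?_)
  have h : ‖inner ℂ (ψ k) (Y ω)‖ ≤ ‖X ω‖ := (norm_inner_le_norm _ _).trans_eq (by
    rw [ψ.orthonormal.1 k, one_mul, hYX])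
  rw [norm_mul, Real.norm_eq_abs, norm_pow, norm_norm]
  exact (mul_le_of_le_one_left (by positivity) (hc1 ω)).trans
    (pow_le_pow_left₀ (norm_nonneg _) h 2)

end Integrability

/-! ### Expected powers after n defects and weighted single steps. -/

section Expectation

variable {H : Type*} [NormedAddCommGroup H] [InnerProductSpace ℂ H] [CompleteSpace H]
  [MeasurableSpace H] [BorelSpace H] {ι : Type*} [Countable ι]
  {Ω : Type*} [MeasurableSpace Ω] {μ : Measure Ω} [IsProbabilityMeasure μ]
  {ψ : HilbertBasis ι ℂ H} {ev : ι → ℝ} {β : H →L[ℂ] H} {ε : ℝ}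
  {T : ℝ} {g₀ : ℝ → ℝ} {S : ℝ → H →L[ℂ] H} {d : ℕ → Ω → ℝ} {X : Ω → H}

/-- Expected powers after `n` defects are obtained by iterating the transition matrix. -/
theorem integral_stateAt_eq_iterate (hD : IsDefect (coupling ψ ev β) g₀ T)
    (hS : IsPropagator (coupling ψ ev β) g₀ ε S) (hdmeas : ∀ l, Measurable (d l))
    (hindep : iIndepFun d μ)
    (hphase : ∀ l : ℕ, ∀ j k : ι, j ≠ k →
      ∫ ω, Complex.exp (Complex.I * ((ev j - ev k : ℝ) : ℂ) * (d l ω : ℂ)) ∂μ = 0)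
    (hX : Measurable X) (hX2 : Integrable (fun ω => ‖X ω‖ ^ 2) μ)
    (hXd : IndepFun X (fun ω l => d l ω) μ) (n : ℕ) :
    (fun k => ∫ ω, ‖inner ℂ (ψ k) (stateAt ψ ev (S T) T (fun i => d i ω) (X ω) n)‖ ^ 2 ∂μ) =
      (act (trans ψ (S T)))^[n] (power μ ψ X) := by
  have := secondCountable_of_hilbertBasis ψ
  have hU : ∀ x, ‖S T x‖ = ‖x‖ := fun x => hS.norm_apply hD T x
  induction n with
  | zero => rfl
  | succ n ih =>
    rw [Function.iterate_succ_apply', ← ih]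
    ext k
    have h := integral_weight_norm_sq ψ (hdmeas n) (hphase n)
      (measurable_stateAt ψ ev (S T) T hdmeas hX n)
      (by simpa only [norm_stateAt ψ ev hU] using hX2) (measurable_const (a := (1 : ℝ)))
      (fun _ => by simp)
      (indepFun_miscount_stateAt ψ ev (S T) T hdmeas hindep hX hXd 0 0 n).2 hU k
    simp only [one_mul] at h
    simp only [stateAt, norm_inner_flow]
    exact h

/-- A single step weighted by a function of the past changes expected powers by `O(ε²)`. -/
theorem l1Le_integral_miscount (hD : IsDefect (coupling ψ ev β) g₀ T)
    (hS : IsPropagator (coupling ψ ev β) g₀ ε S) (hdmeas : ∀ l, Measurable (d l))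
    (hindep : iIndepFun d μ)
    (hphase : ∀ l : ℕ, ∀ j k : ι, j ≠ k →
      ∫ ω, Complex.exp (Complex.I * ((ev j - ev k : ℝ) : ℂ) * (d l ω : ℂ)) ∂μ = 0)
    (hX : Measurable X) (hX2 : Integrable (fun ω => ‖X ω‖ ^ 2) μ)
    (hXd : IndepFun X (fun ω l => d l ω) μ) (t : ℝ) (n l : ℕ) :
    L1Le (fun k => ∫ ω, miscount T t n l (fun i => d i ω) *
        (‖inner ℂ (ψ k) (stateAt ψ ev (S T) T (fun i => d i ω) (X ω) (l + 1))‖ ^ 2 -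
          ‖inner ℂ (ψ k) (stateAt ψ ev (S T) T (fun i => d i ω) (X ω) l)‖ ^ 2) ∂μ)
      (2 * ε ^ 2 * ((∫ ω, |miscount T t n l (fun i => d i ω)| ∂μ) * ∫ ω, ‖X ω‖ ^ 2 ∂μ)) := by
  classical
  have := secondCountable_of_hilbertBasis ψ
  have hU : ∀ x, ‖S T x‖ = ‖x‖ := fun x => hS.norm_apply hD T x
  have hdm : Measurable fun ω => (fun i => d i ω) := measurable_pi_lambda _ hdmeas
  have hcm : Measurable fun ω => miscount T t n l (fun i => d i ω) :=
    (measurable_miscount T t n l).comp hdm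
  have hc1 : ∀ ω, |miscount T t n l (fun i => d i ω)| ≤ 1 := fun ω => abs_miscount_le_one T t n l _
  have hYm := measurable_stateAt ψ ev (S T) T hdmeas hX
  have hint : ∀ m k, Integrable (fun ω => miscount T t n l (fun i => d i ω) *
      ‖inner ℂ (ψ k) (stateAt ψ ev (S T) T (fun i => d i ω) (X ω) m)‖ ^ 2) μ := fun m k =>
    integrable_mul_norm_sq_inner (hYm m) (fun ω => norm_stateAt ψ ev hU _ _ _ _) hX2 hcm hc1 k
  set q : ι → ℝ := fun k => ∫ ω, miscount T t n l (fun i => d i ω) *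
      ‖inner ℂ (ψ k) (stateAt ψ ev (S T) T (fun i => d i ω) (X ω) l)‖ ^ 2 ∂μ with hq
  -- The weight depends on the waiting times only, so it is independent of the initial power.
  have hmul : ∫ ω, |miscount T t n l (fun i => d i ω)| * ‖X ω‖ ^ 2 ∂μ =
      (∫ ω, |miscount T t n l (fun i => d i ω)| ∂μ) * ∫ ω, ‖X ω‖ ^ 2 ∂μ :=
    hXd.symm.integral_fun_comp_mul_comp (f := fun z => |miscount T t n l z|)
      (g := fun x : H => ‖x‖ ^ 2) hdm.aemeasurable hX.aemeasurable
      (measurable_miscount T t n l).abs.aestronglyMeasurable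
      (by fun_prop : Continuous fun x : H => ‖x‖ ^ 2).aestronglyMeasurable
  have hq1 : L1Le q ((∫ ω, |miscount T t n l (fun i => d i ω)| ∂μ) * ∫ ω, ‖X ω‖ ^ 2 ∂μ) := by
    rw [← hmul]
    refine L1Le.integral (hint l) ?_ (Filter.Eventually.of_forall fun ω => ?_)
    · refine hX2.mono' (hcm.abs.mul (hX.norm.pow_const 2)).aestronglyMeasurable
        (Filter.Eventually.of_forall fun ω => ?_)
      rw [Real.norm_eq_abs, abs_mul, abs_abs, abs_of_nonneg (sq_nonneg ‖X ω‖)]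
      exact mul_le_of_le_one_left (sq_nonneg _) (hc1 ω)
    · have h := (l1Le_norm_sq ψ (stateAt ψ ev (S T) T (fun i => d i ω) (X ω) l)).const_mul
        (miscount T t n l (fun i => d i ω))
      rwa [norm_stateAt ψ ev hU] at h
  -- The l-th weight and state are jointly independent of d_l, so the phase average acts on the
  -- weighted powers as on the plain ones.
  have hstep : ∀ k, ∫ ω, miscount T t n l (fun i => d i ω) *
      ‖inner ℂ (ψ k) (stateAt ψ ev (S T) T (fun i => d i ω) (X ω) (l + 1))‖ ^ 2 ∂μ =
      act (trans ψ (S T)) q k := fun k => by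
    simp only [stateAt, norm_inner_flow]
    exact integral_weight_norm_sq ψ (hdmeas l) (hphase l) (hYm l)
      (by simpa only [norm_stateAt ψ ev hU] using hX2) hcm hc1
      (indepFun_miscount_stateAt ψ ev (S T) T hdmeas hindep hX hXd t n l).1 hU k
  have h1 : ∀ j, L1Le (fun k : ι => if k = j then (1 : ℝ) else 0) 1 := fun j => by
    simpa using l1Le_single j 1
  refine (L1Le.act (l1Le_trans_sub_one hD hS) (by positivity) hq1).congr fun k => ?_
  have hsub := act_sub_left (l1Le_trans (ψ := ψ) hU) h1 hq1 k
  have h4 : act (fun k j : ι => if k = j then (1 : ℝ) else 0) q k = q k := by simp [act]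
  rw [h4, ← hstep k] at hsub
  simp only [mul_sub]
  rw [integral_sub (hint _ _) (hint _ _)]
  refine hsub.symm.trans ?_
  congr!

end Expectation

end RandomDefects

end

/-! ### Assembly of the error bound. -/

theorem theorem3p2
    {H : Type*} [NormedAddCommGroup H] [InnerProductSpace ℂ H] [CompleteSpace H]
    [MeasurableSpace H] [BorelSpace H]
    {ι : Type*} [Countable ι]
    {Ω : Type*} [MeasurableSpace Ω] (μ : Measure Ω) [IsProbabilityMeasure μ]
    -- the self-adjoint operator with a complete orthonormal set of eigenvectors
    (H₀ : H →ₗ.[ℂ] H) (hH₀ : IsSelfAdjoint H₀)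
    (ψ : HilbertBasis ι ℂ H) (ev : ι → ℝ)
    (hdom : ∀ j, ψ j ∈ H₀.domain)
    (heig : ∀ j, H₀ ⟨ψ j, hdom j⟩ = (ev j : ℂ) • ψ j)
    -- the coupling operator
    (β : H →L[ℂ] H) (hβ : IsSelfAdjoint β) (hβ1 : ‖β‖ = 1)
    -- the profile of a single defect
    (T : ℝ) (g₀ : ℝ → ℝ) (hg₀ : MemLp g₀ 2 volume)
    (hsupp : Function.support g₀ ⊆ Set.Icc 0 T) (hg₀1 : ∫ t, |g₀ t| = 1)
    -- the random waiting times
    (d : ℕ → Ω → ℝ) (hdmeas : ∀ l, Measurable (d l))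
    (hindep : iIndepFun d μ) (hident : ∀ l, IdentDistrib (d l) (d 0) μ μ)
    (hnonneg : ∀ l, ∀ᵐ ω ∂μ, 0 ≤ d l ω)
    (hphase : ∀ l : ℕ, ∀ j k : ι, j ≠ k →
      ∫ ω, Complex.exp (Complex.I * ((ev j - ev k : ℝ) : ℂ) * (d l ω : ℂ)) ∂μ = 0)
    (hmoment : MemLp (d 0) 3 μ) :
    ∃ C : ℝ, 0 ≤ C ∧
      -- (possibly random) initial data of finite expected power, independent of the waiting times
      ∀ φ₀ : Ω → H, MemLp φ₀ 2 μ → IndepFun φ₀ (fun ω l => d l ω) μ →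
      ∀ ε : ℝ, |ε| ≤ 1 →
      ∀ φ : Ω → ℝ → H,
        (∀ᵐ ω ∂μ, RandomDefects.IsSolution H₀ β ε
          (RandomDefects.train T g₀ (fun l => d l ω)) (φ₀ ω) (φ ω)) →
      ∀ t : ℝ, 0 ≤ t → t * |ε| ^ 3 ≤ 1 →
        (∀ k, Integrable (fun ω => ‖inner ℂ (ψ k) (φ ω t)‖ ^ 2) μ) ∧
        Summable (fun k => |RandomDefects.power μ ψ (fun ω => φ ω t) k -
          (RandomDefects.transfer ψ ev β g₀ ε)^[⌊t / (T + ∫ ω, d 0 ω ∂μ)⌋₊]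
            (RandomDefects.power μ ψ φ₀) k|) ∧
        ∑' k, |RandomDefects.power μ ψ (fun ω => φ ω t) k -
          (RandomDefects.transfer ψ ev β g₀ ε)^[⌊t / (T + ∫ ω, d 0 ω ∂μ)⌋₊]
            (RandomDefects.power μ ψ φ₀) k|
          ≤ C * (∫ ω, ‖φ₀ ω‖ ^ 2 ∂μ) * max (t * |ε| ^ 3) (|ε| ^ ((4 : ℝ) / 5)) := by
  have hD := RandomDefects.isDefect_coupling (ψ := ψ) (ev := ev) hβ hβ1 hg₀.1 hsupp hg₀1
  have hT := hD.pos
  have h2 : MemLp (d 0) 2 μ := hmoment.mono_exponent (by norm_num)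
  have hM : 0 ≤ ∫ ω, d 0 ω ∂μ := integral_nonneg_of_ae (hnonneg 0)
  set c := T + ∫ ω, d 0 ω ∂μ with hc
  have hc0 : 0 < c := by linarith
  set V := variance (d 0) μ with hV
  have hV0 : 0 ≤ V := variance_nonneg _ _
  refine ⟨12 + 8 * √(V / (T * c ^ 2)) + 8 * √(V / c ^ 2) + 4 / c, by positivity, ?_⟩
  intro φ₀ hφ₀ hind ε hε φ hφ t ht _
  obtain ⟨S, hS⟩ := hD.exists_propagator hε
  have hU : ∀ x, ‖S T x‖ = ‖x‖ := fun x => hS.norm_apply hD T x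
  have := RandomDefects.secondCountable_of_hilbertBasis ψ
  -- A measurable version of the initial state, almost surely equal to it.
  set X : Ω → H := hφ₀.1.mk φ₀ with hXdef
  have hX : Measurable X := hφ₀.1.stronglyMeasurable_mk.measurable
  have hXeq : φ₀ =ᵐ[μ] X := hφ₀.1.ae_eq_mk
  have hX2 : Integrable (fun ω => ‖X ω‖ ^ 2) μ :=
    (hφ₀.ae_eq hXeq).integrable_norm_pow (by norm_num : (2 : ℕ) ≠ 0)
  have hXd : IndepFun X (fun ω l => d l ω) μ := hind.congr hXeq (Filter.EventuallyEq.refl _ _)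
  have hpow : RandomDefects.power μ ψ φ₀ = RandomDefects.power μ ψ X := by
    ext k
    exact integral_congr_ae (hXeq.mono fun ω hω => by simp only [hω])
  have hnorm : ∫ ω, ‖φ₀ ω‖ ^ 2 ∂μ = ∫ ω, ‖X ω‖ ^ 2 ∂μ :=
    integral_congr_ae (hXeq.mono fun ω hω => by simp only [hω])
  rw [hpow, hnorm]
  set A := ∫ ω, ‖X ω‖ ^ 2 ∂μ with hA
  have hA0 : 0 ≤ A := integral_nonneg fun _ => sq_nonneg _
  have hgood : ∀ᵐ ω ∂μ, (∀ l, 0 ≤ d l ω) ∧ RandomDefects.IsSolution H₀ β ε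
      (RandomDefects.train T g₀ (fun l => d l ω)) (X ω) (φ ω) := by
    filter_upwards [ae_all_iff.2 hnonneg, hφ, hXeq] with ω h1 h2 h3
    exact ⟨h1, h3 ▸ h2⟩
  set n := ⌊t / c⌋₊ with hn
  -- Each cycle lasts at least T, so fewer than K cycles are completed by time t and sums over
  -- defects can be cut off at K.
  set K := ⌊t / T⌋₊ + 1 with hK
  have hKt : t < K * T := by
    rw [hK, ← div_lt_iff₀ hT]
    push_cast
    exact Nat.lt_floor_add_one _
  have hnK : n ≤ K := by
    have h : t / c ≤ t / T := div_le_div_of_nonneg_left ht hT (by linarith)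
    exact (Nat.floor_le_floor h).trans (Nat.le_succ _)
  have hdm : Measurable fun ω => (fun i => d i ω) := measurable_pi_lambda _ hdmeas
  have hPint : ∀ k, Integrable (fun ω => ‖inner ℂ (ψ k) (φ ω t)‖ ^ 2) μ := by
    intro k
    refine hX2.mono' ⟨_, ((RandomDefects.measurable_observed hD hS K k (t := t)).comp
      (hdm.prodMk hX)).stronglyMeasurable, ?_⟩ ?_
    · filter_upwards [hgood] with ω hω
      exact (hω.2.eq_observed hdom heig hD hS hω.1 ht hKt k).1
    · filter_upwards [hgood] with ω hω
      rw [Real.norm_eq_abs, abs_of_nonneg (sq_nonneg _)]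
      exact (hω.2.eq_observed hdom heig hD hS hω.1 ht hKt k).2
  set Y : ℕ → Ω → H := fun l ω =>
    RandomDefects.stateAt ψ ev (S T) T (fun i => d i ω) (X ω) l with hY
  have hYint : ∀ l k, Integrable (fun ω => ‖inner ℂ (ψ k) (Y l ω)‖ ^ 2) μ := fun l k => by
    have h := RandomDefects.integrable_mul_norm_sq_inner (ψ := ψ)
      (RandomDefects.measurable_stateAt ψ ev (S T) T hdmeas hX l)
      (fun ω => RandomDefects.norm_stateAt ψ ev hU _ _ _ _) hX2 (measurable_const (a := (1 : ℝ)))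
      (fun _ => by simp) k
    simpa only [one_mul] using h
  have hcint : ∀ l k, Integrable (fun ω => RandomDefects.miscount T t n l (fun i => d i ω) *
      (‖inner ℂ (ψ k) (Y (l + 1) ω)‖ ^ 2 - ‖inner ℂ (ψ k) (Y l ω)‖ ^ 2)) μ := fun l k => by
    refine ((hYint (l + 1) k).sub (hYint l k)).bdd_mul (c := 1)
      ((RandomDefects.measurable_miscount T t n l).comp hdm).aestronglyMeasurable
      (Filter.Eventually.of_forall fun ω => ?_)
    exact RandomDefects.abs_miscount_le_one T t n l _
  have hE1 := RandomDefects.L1Le.integral (μ := μ)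
    (p := fun ω k => ‖inner ℂ (ψ k) (φ ω t)‖ ^ 2 - ‖inner ℂ (ψ k) (Y n ω)‖ ^ 2 -
      ∑ l ∈ Finset.range K, RandomDefects.miscount T t n l (fun i => d i ω) *
        (‖inner ℂ (ψ k) (Y (l + 1) ω)‖ ^ 2 - ‖inner ℂ (ψ k) (Y l ω)‖ ^ 2))
    (c := fun ω => 2 * |ε| * ‖X ω‖ ^ 2)
    (fun k => ((hPint k).sub (hYint n k)).sub (integrable_finsetSum _ fun l _ => hcint l k))
    (hX2.const_mul _) (hgood.mono fun ω hω =>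
      hω.2.l1Le_power_sub hdom heig hD hS hω.1 ht hnK hKt)
  rw [integral_const_mul] at hE1
  have hE2 := RandomDefects.L1Le.sum (Finset.range K) fun l _ =>
    RandomDefects.l1Le_integral_miscount hD hS hdmeas hindep hphase hX hX2 hXd t n l
  have hp0 : RandomDefects.L1Le (RandomDefects.power μ ψ X) A :=
    RandomDefects.L1Le.integral (p := fun ω k => ‖inner ℂ (ψ k) (X ω)‖ ^ 2)
      (fun k => hYint 0 k) hX2 (Filter.Eventually.of_forall fun ω => RandomDefects.l1Le_norm_sq ψ _)
  have hE3 := (RandomDefects.l1Le_iterate_sub hD hS hβ hε hp0 n).2.2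
  have hsum : ∑ l ∈ Finset.range K, 2 * ε ^ 2 *
      ((∫ ω, |RandomDefects.miscount T t n l (fun i => d i ω)| ∂μ) * A) ≤
      2 * ε ^ 2 * ((4 * √(K * V / c ^ 2) + 5) * A) := by
    rw [← Finset.mul_sum, ← Finset.sum_mul]
    refine mul_le_mul_of_nonneg_left (mul_le_mul_of_nonneg_right ?_ hA0) (by positivity)
    refine le_trans (Finset.sum_le_sum fun l hl => ?_)
      (RandomDefects.sum_chebWeight_dist_le (w := K * V / c ^ 2) (by positivity) n K)
    exact RandomDefects.integral_abs_miscount_le hdmeas hindep hident h2 hc hc0 ht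
      (Finset.mem_range.1 hl).le
  have hn' : (n : ℝ) ≤ t / c := Nat.floor_le (div_nonneg ht hc0.le)
  have hK' : (K : ℝ) ≤ t / T + 1 := by
    rw [hK]; push_cast
    linarith [Nat.floor_le (div_nonneg ht hT.le)]
  have hmain : RandomDefects.L1Le (fun k => RandomDefects.power μ ψ (fun ω => φ ω t) k -
      (RandomDefects.transfer ψ ev β g₀ ε)^[n] (RandomDefects.power μ ψ X) k)
      ((12 + 8 * √(V / (T * c ^ 2)) + 8 * √(V / c ^ 2) + 4 / c) * A *
        max (t * |ε| ^ 3) (|ε| ^ ((4 : ℝ) / 5))) := by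
    -- The three errors are the unfinished defect, the fluctuation of the number of defects, and the
    -- replacement of Q by T_ε over n steps.
    refine (((hE1.add hE2).add hE3).mono ?_).congr fun k => ?_
    · have := RandomDefects.error_le hA0 hε ht hc0 hT hV0 hn' hK'
      linarith
    · have hit := congrFun (RandomDefects.integral_stateAt_eq_iterate hD hS hdmeas hindep hphase
        hX hX2 hXd n) k
      have hPY : Integrable (fun ω => ‖inner ℂ (ψ k) (φ ω t)‖ ^ 2 -
          ‖inner ℂ (ψ k) (Y n ω)‖ ^ 2) μ := (hPint k).sub (hYint n k)
      rw [← hit, integral_sub hPY (integrable_finsetSum _ fun l _ => hcint l k),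
        integral_sub (hPint k) (hYint n k), integral_finsetSum _ fun l _ => hcint l k]
      simp only [RandomDefects.power, hY]
      ring
  exact ⟨hPint, hmain.summable, hmain.tsum_le⟩
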